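/- **Setting.** Let $K$ be a locally compact metric space, $\mu$ a $\sigma$-finite Radon (regular Borel) measure on $K$ with full support, and $(\mathcal E,\mathcal F)$ a regular, strongly local (symmetric) Dirichlet form on $L^2(K,\mu)$; strong locality means $\mathcal E(u,v)=0$ whenever $u,v\in\mathcal F$ and $u$ is constant on the support of $v$. Put $\mathcal C=C_c(K)\cap\mathcal F$. For $f\in\mathcal C$ let $\Gamma(f)$ be the energy measure, i.e. the unique finite regular Borel measure with $$\int\varphi\,d\Gamma(f)=\mathcal E(\varphi f,f)-\tfrac12\mathcal E(\varphi,f^2)\qquad(\varphi\in\mathcal C),$$ and let $\Gamma(a,c)=\tfrac14(\Gamma(a+c)-\Gamma(a-c))$. Let $\mathcal H$ be the Hilbert space obtained from $\mathcal C\otimes\mathcal C$ with the positive semidefinite bilinear form $\langle a\otimes b,c\otimes d\rangle_{\mathcal H}=\int_K bd\,d\Gamma(a,c)$ by factoring out the null space and completing. If $a\in\mathcal C$ and $g$ is a uniform limit of elements of $\mathcal C$, then $a\otimes g\in\mathcal H$ denotes the limit of $a\otimes b$ as $b\to g$ uniformly, $b\in\mathcal C$. For an open set $U\subseteq\mathbb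 R^m$ let $C^1_0(U)$ be the set of functions that are $C^1$ on $U$, continuous on $\overline U$ and vanish at infinity. Let $\Phi=(\phi^1,\dots,\phi^m)$ with $\phi^i\in\mathcal C$ be a coordinate sequence: * (CO1) each $\Gamma(\phi^i,\phi^j)$ is absolutely continuous with respect to $\mu$, with density $Z^{ij}=d\Gamma(\phi^i,\phi^j)/d\mu\in L^1(K,\mu)\cap L^\infty(K,\mu)$; * (CO2) $\{F\circ\Phi : F\in C_0^1(\mathbb R^m)\}$ is a subset of $\mathcal C$ and is dense in $\mathcal C$ with respect to $\mathcal E_1(f,g)=\mathcal E(f,g)+\langle f,g\rangle_{L^2(K,\mu)}$. (This forces $K$ to be compact.) Let $K_\Phi=\Phi(K)$ and let $U\subseteq\mathbb R^m$ be open with $K_\Phi\subseteq U$. For a continuous 1-form $\omega=\sum_i\omega_i\,dx^i$ on $U$ put $\pi\omega=\sum_i\phi^i\otimes(\omega_i\circ\Phi)\in\mathcal H$ and $\|\omega\|_Z=\|\pi\omega\|_{\mathcal H}$. Let $\mathcal I_{K_\Phi}=\{f\in C_0^1(U): f=0\text{ on }K_\Phi\}$, let $T_pK_\Phi=\{X\in\mathbb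 R^m : X\cdot\nabla f(p)=0\ \text{for all }f\in\mathcal I_{K_\Phi}\}$ for $p\in K_\Phi$, and for $x\in K$ let $P_x$ be the matrix of the orthogonal projection of $\mathbb R^m$ onto $T_{\Phi(x)}K_\Phi$ and $Z_x=(Z^{ij}(x))_{i,j}$. **Proposition.** All these objects are well defined (the energy measures, the positive semidefinite form on $\mathcal C\otimes\mathcal C$ and the elements $\phi^i\otimes(\omega_i\circ\Phi)$ exist), and: 1. For every continuous 1-form $\omega$ on $U$, the functions $(\omega_i\circ\Phi)Z^{ij}(\omega_j\circ\Phi)$ are $\mu$-integrable and $$\|\omega\|_Z^2=\int_K\sum_{i,j=1}^m(\omega_i\circ\Phi)\,Z^{ij}\,(\omega_j\circ\Phi)\,d\mu .$$ 2. For every $f\in C_0^1(U)$, $f\circ\Phi\in\mathcal F$ and $\|df\|_Z^2=\mathcal E(f\circ\Phi,f\circ\Phi)$. 3. $d\mathcal I_{K_\Phi}\subseteq\ker\pi$, i.e. $\pi(df)=0$ for every $f\in\mathcal I_{K_\Phi}$. 4. $P_xZ_xP_x=Z_x$ for $\mu$-almost every $x\in K$. -/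

import Mathlib

open MeasureTheory Filter Topology
open scoped TensorProduct ENNReal

noncomputable section

/-! ### `C¹` functions on open sets of `ℝᵐ`, ideals, tangent spaces -/

/-- `C¹₀(U) = C¹(U) ∩ C₀(closure U)`: functions that are continuously differentiable on `U`,
continuous on the closure of `U`, and vanish at infinity on it.  The elements are represented by
functions on all of `ℝᵐ`, whose values off the closure of `U` are irrelevant. -/
def C10 {m : ℕ} (U : Set (EuclideanSpace ℝ (Fin m))) : Set (EuclideanSpace ℝ (Fin m) → ℝ) :=
  {f | ContDiffOn ℝ 1 f U ∧ ContinuousOn f (closure U) ∧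
    Tendsto f (cocompact (EuclideanSpace ℝ (Fin m)) ⊓ 𝓟 (closure U)) (𝓝 0)}

/-- The ideal `I_K` of the functions in `C¹₀(U)` that vanish on `K`. -/
def vanishingIdeal {m : ℕ} (U K : Set (EuclideanSpace ℝ (Fin m))) :
    Set (EuclideanSpace ℝ (Fin m) → ℝ) :=
  {f | f ∈ C10 U ∧ ∀ p ∈ K, f p = 0}

/-- The tangent space `T_p K = {X | X f = 0 for all f ∈ I_K}` at `p ∈ K ⊆ U`, a subspace of
`T_p U = ℝᵐ`. -/
def tangentSpaceOf {m : ℕ} (U K : Set (EuclideanSpace ℝ (Fin m))) (p : EuclideanSpace ℝ (Fin m)) :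
    Submodule ℝ (EuclideanSpace ℝ (Fin m)) where
  carrier := {X | ∀ f ∈ vanishingIdeal U K, fderiv ℝ f p X = 0}
  add_mem' := by
    intro X Y hX hY f hf
    rw [map_add, hX f hf, hY f hf, add_zero]
  zero_mem' := by
    intro f _
    exact map_zero _
  smul_mem' := by
    intro c X hX f hf
    rw [map_smul, hX f hf, smul_zero]

/-- The matrix, in the standard basis, of the orthogonal projection of `ℝᵐ` onto `T_p K`. -/
def tangentProj {m : ℕ} (U K : Set (EuclideanSpace ℝ (Fin m))) (p : EuclideanSpace ℝ (Fin m)) :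
    Matrix (Fin m) (Fin m) ℝ :=
  Matrix.of fun i j =>
    (tangentSpaceOf U K p).starProjection (EuclideanSpace.single j (1 : ℝ)) i

/-- The coefficients `∂f/∂xⁱ` of the 1-form `df`. -/
def dForm {m : ℕ} (f : EuclideanSpace ℝ (Fin m) → ℝ) :
    Fin m → EuclideanSpace ℝ (Fin m) → ℝ :=
  fun i p => fderiv ℝ f p (EuclideanSpace.single i (1 : ℝ))

/-- `∑ᵢ ωᵢ dxⁱ` is a continuous 1-form on `U`.  No boundedness or decay of the coefficients is
asked for, so this includes all forms with coefficients in `C₀(closure U)` and all `df` with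
`f ∈ C¹₀(U)`. -/
def IsContForm {m : ℕ} (U : Set (EuclideanSpace ℝ (Fin m)))
    (ω : Fin m → EuclideanSpace ℝ (Fin m) → ℝ) : Prop :=
  ∀ i, ContinuousOn (ω i) U

/-! ### Dirichlet forms -/

/-- A (closed, symmetric, Markovian, densely defined) Dirichlet form on `L²(K, μ)`. -/
structure DirichletForm {K : Type*} [MeasurableSpace K] (μ : Measure K) where
  /-- The domain `F`. -/
  domain : Submodule ℝ (Lp ℝ 2 μ)
  /-- The bilinear form `E`. -/
  form : domain →ₗ[ℝ] domain →ₗ[ℝ] ℝ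
  dense_domain : Dense (domain : Set (Lp ℝ 2 μ))
  symm : ∀ u v : domain, form u v = form v u
  nonneg : ∀ u : domain, 0 ≤ form u u
  /-- `F` is complete with respect to `E₁(u, v) = E(u, v) + ⟨u, v⟩`. -/
  closed : ∀ u : ℕ → domain,
    (∀ ε > 0, ∃ N, ∀ k ≥ N, ∀ l ≥ N,
      form (u k - u l) (u k - u l) + ‖((u k - u l : domain) : Lp ℝ 2 μ)‖ ^ 2 < ε) →
    ∃ v : domain, Tendsto
      (fun k => form (u k - v) (u k - v) + ‖((u k - v : domain) : Lp ℝ 2 μ)‖ ^ 2) atTop (𝓝 0)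
  /-- The unit contraction operates. -/
  markov : ∀ u : domain, ∃ v : domain,
    ((v : Lp ℝ 2 μ) =ᵐ[μ] fun x => min (max 0 ((u : Lp ℝ 2 μ) x)) 1) ∧ form v v ≤ form u u

namespace DirichletForm

section Basic

variable {K : Type*} [MeasurableSpace K] {μ : Measure K}

/-- The (class of the) function `f` belongs to the domain `F`. -/
def InDomain (D : DirichletForm μ) (f : K → ℝ) : Prop :=
  ∃ h : MemLp f 2 μ, h.toLp f ∈ D.domain

open Classical in
/-- `E(f, g)` for functions `f`, `g` in the domain (and `0` for other functions). -/
def energy (D : DirichletForm μ) (f g : K → ℝ) : ℝ :=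
  if h : D.InDomain f ∧ D.InDomain g then
    D.form ⟨h.1.choose.toLp f, h.1.choose_spec⟩ ⟨h.2.choose.toLp g, h.2.choose_spec⟩
  else 0

/-- `E₁(f, f) = E(f, f) + ‖f‖²_{L²}`. -/
def energyOne (D : DirichletForm μ) (f : K → ℝ) : ℝ :=
  D.energy f f + ∫ x, f x ^ 2 ∂μ

/-- Strong locality: `E(u, v) = 0` whenever `u` is (a.e.) constant on the support of `v`, that is
the support of the measure `|v| μ`. -/
def IsStronglyLocal [TopologicalSpace K] (D : DirichletForm μ) : Prop :=
  ∀ (u v : D.domain) (c : ℝ),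
    (∀ᵐ x ∂μ, x ∈ (μ.withDensity fun y => ‖(v : Lp ℝ 2 μ) y‖ₑ).support →
      (u : Lp ℝ 2 μ) x = c) →
    D.form u v = 0

lemma InDomain.add {D : DirichletForm μ} {f g : K → ℝ} (hf : D.InDomain f) (hg : D.InDomain g) :
    D.InDomain (f + g) := by
  obtain ⟨h1, h1'⟩ := hf
  obtain ⟨h2, h2'⟩ := hg
  refine ⟨h1.add h2, ?_⟩
  rw [MemLp.toLp_add h1 h2]
  exact D.domain.add_mem h1' h2'

lemma InDomain.smul {D : DirichletForm μ} {f : K → ℝ} (c : ℝ) (hf : D.InDomain f) :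
    D.InDomain (c • f) := by
  obtain ⟨h1, h1'⟩ := hf
  refine ⟨h1.const_smul c, ?_⟩
  rw [MemLp.toLp_const_smul c h1]
  exact D.domain.smul_mem c h1'

lemma InDomain.zero (D : DirichletForm μ) : D.InDomain (0 : K → ℝ) := by
  refine ⟨MemLp.zero, ?_⟩
  rw [MemLp.toLp_zero]
  exact D.domain.zero_mem

end Basic

section Algebra

variable {K : Type*} [TopologicalSpace K] [MeasurableSpace K] {μ : Measure K}

/-- The Dirichlet algebra `C = C_c(K) ∩ F`. -/
def core (D : DirichletForm μ) : Submodule ℝ (K → ℝ) where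
  carrier := {f | Continuous f ∧ HasCompactSupport f ∧ D.InDomain f}
  add_mem' := by
    rintro f g ⟨hf, hf', hf''⟩ ⟨hg, hg', hg''⟩
    exact ⟨hf.add hg, hf'.add hg', hf''.add hg''⟩
  zero_mem' := ⟨continuous_zero, HasCompactSupport.zero, InDomain.zero D⟩
  smul_mem' := by
    rintro c f ⟨hf, hf', hf''⟩
    exact ⟨hf.const_smul c, hf'.smul_left (f := fun _ => c), hf''.smul c⟩

/-- Regularity: `C` is uniformly dense in `C_c(K)` and `E₁`-dense in `F`. -/
def IsRegular (D : DirichletForm μ) : Prop :=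
  (∀ f : K → ℝ, Continuous f → HasCompactSupport f →
    ∀ ε > 0, ∃ g ∈ D.core, ∀ x, |f x - g x| < ε) ∧
  (∀ f : K → ℝ, D.InDomain f → ∀ ε > 0, ∃ g ∈ D.core, D.energyOne (f - g) < ε)

/-- `ν` is the energy measure of `f ∈ C`: the finite regular Borel measure with
`∫ φ dν = E(φ f, f) - ½ E(φ, f²)` for all `φ ∈ C`. -/
def IsEnergyMeasure (D : DirichletForm μ) (f : D.core) (ν : Measure K) : Prop :=
  IsFiniteMeasure ν ∧ ν.Regular ∧
    ∀ φ : D.core, ∫ x, φ.1 x ∂ν = D.energy (φ.1 * f.1) f.1 - D.energy φ.1 (f.1 * f.1) / 2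

open Classical in
/-- The energy measure `Γ(f)` of `f ∈ C`: the measure characterized by `IsEnergyMeasure`. -/
def energyMeasure (D : DirichletForm μ) (f : D.core) : Measure K :=
  if h : ∃ ν : Measure K, D.IsEnergyMeasure f ν then h.choose else 0

instance (D : DirichletForm μ) (f : D.core) : IsFiniteMeasure (D.energyMeasure f) := by
  unfold energyMeasure
  split_ifs with h
  · exact h.choose_spec.1
  · infer_instance

/-- The mutual energy measure `Γ(a, c) = ¼ (Γ(a + c) - Γ(a - c))`, a signed measure. -/
def mutualEnergyMeasure (D : DirichletForm μ) (a c : D.core) : SignedMeasure K :=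
  (1 / 4 : ℝ) • ((D.energyMeasure (a + c)).toSignedMeasure -
    (D.energyMeasure (a - c)).toSignedMeasure)

/-- The integral `∫ φ dΓ(a, c)`. -/
def mutualEnergyIntegral (D : DirichletForm μ) (a c : D.core) (φ : K → ℝ) : ℝ :=
  (1 / 4 : ℝ) * ((∫ x, φ x ∂(D.energyMeasure (a + c))) - ∫ x, φ x ∂(D.energyMeasure (a - c)))

/-! ### The Hilbert space of Dirichlet differential forms -/

/-- The vector space `C ⊗ C`. -/
def PreH (D : DirichletForm μ) : Type _ := D.core ⊗[ℝ] D.core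

instance (D : DirichletForm μ) : AddCommGroup D.PreH :=
  inferInstanceAs (AddCommGroup (D.core ⊗[ℝ] D.core))

instance (D : DirichletForm μ) : Module ℝ D.PreH :=
  inferInstanceAs (Module ℝ (D.core ⊗[ℝ] D.core))

/-- The simple tensor `a ⊗ b`. -/
def simpleTensor (D : DirichletForm μ) (a b : D.core) : D.PreH := a ⊗ₜ[ℝ] b

/-- `B` is the positive semidefinite symmetric bilinear form on `C ⊗ C` with
`B(a ⊗ b, c ⊗ d) = ∫ b d dΓ(a, c)`. -/
def IsTensorForm (D : DirichletForm μ) (B : LinearMap.BilinForm ℝ D.PreH) : Prop :=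
  B.IsPosSemidef ∧ ∀ a b c d : D.core,
    B (D.simpleTensor a b) (D.simpleTensor c d) = D.mutualEnergyIntegral a c (b.1 * d.1)

open Classical in
/-- The semi-inner product on `C ⊗ C`: the form characterized by `IsTensorForm`. -/
def tensorForm (D : DirichletForm μ) : LinearMap.BilinForm ℝ D.PreH :=
  if h : ∃ B : LinearMap.BilinForm ℝ D.PreH, D.IsTensorForm B then h.choose else 0

lemma tensorForm_isPosSemidef (D : DirichletForm μ) : D.tensorForm.IsPosSemidef := by
  unfold tensorForm
  split_ifs with h
  · exact h.choose_spec.1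
  · exact
      { eq := fun _ _ => rfl
        nonneg := fun _ => le_refl (0 : ℝ) }

/-- `tensorForm` as a semi-inner product. -/
@[reducible] def tensorCore (D : DirichletForm μ) : PreInnerProductSpace.Core ℝ D.PreH where
  inner s t := D.tensorForm s t
  conj_inner_symm s t := D.tensorForm_isPosSemidef.isSymm.eq t s
  re_inner_nonneg s := D.tensorForm_isPosSemidef.isNonneg.nonneg s
  add_left s t r := by rw [map_add, LinearMap.add_apply]
  smul_left s t c := by rw [map_smul, LinearMap.smul_apply]; rfl

instance (D : DirichletForm μ) : SeminormedAddCommGroup D.PreH :=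
  letI := D.tensorCore
  InnerProductSpace.Core.toSeminormedAddCommGroup (𝕜 := ℝ)

instance (D : DirichletForm μ) : InnerProductSpace ℝ D.PreH :=
  InnerProductSpace.ofCore D.tensorCore

/-- The Hilbert space `H`: `C ⊗ C` modulo the null space of its semi-inner product, completed.
(`UniformSpace.Completion` is the Hausdorff completion, so it includes the quotient.) -/
abbrev H (D : DirichletForm μ) : Type _ := UniformSpace.Completion D.PreH

/-- The filter of the elements `b ∈ C` that converge to `g` uniformly on `K`. -/
def uniformNhds (D : DirichletForm μ) (g : K → ℝ) : Filter D.core :=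
  ⨅ ε : {ε : ℝ // 0 < ε}, 𝓟 {b : D.core | ∀ x, |b.1 x - g x| ≤ ε.1}

/-- The element `a ⊗ g` of `H` for `a ∈ C` and `g` a uniform limit of elements of `C`: the limit of
`a ⊗ b` for `b → g` uniformly, `b ∈ C`. -/
def tensor (D : DirichletForm μ) (a : D.core) (g : K → ℝ) : D.H :=
  @limUnder D.H _ D.core ⟨0⟩ (D.uniformNhds g) (fun b => (D.simpleTensor a b : D.H))

/-! ### Coordinates -/

/-- The map `Φ = (φ¹, …, φᵐ) : K → ℝᵐ`. -/
def coordMap (D : DirichletForm μ) {m : ℕ} (φ : Fin m → D.core) (x : K) :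
    EuclideanSpace ℝ (Fin m) :=
  WithLp.toLp 2 fun i => (φ i).1 x

/-- `Z^{ij} = dΓ(φⁱ, φʲ)/dμ`. -/
def Z (D : DirichletForm μ) {m : ℕ} (φ : Fin m → D.core) (x : K) : Matrix (Fin m) (Fin m) ℝ :=
  Matrix.of fun i j => (D.mutualEnergyMeasure (φ i) (φ j)).rnDeriv μ x

/-- `Φ` is a coordinate sequence: the densities `dΓ(φⁱ, φʲ)/dμ` exist and lie in `L¹ ∩ L^∞`, and
`C¹(Φ) = {F ∘ Φ | F ∈ C¹₀(ℝᵐ)}` is an `E₁`-dense subset of `C`. -/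
structure IsCoordinateSequence (D : DirichletForm μ) {m : ℕ} (φ : Fin m → D.core) : Prop where
  absolutelyContinuous : ∀ i j,
    VectorMeasure.AbsolutelyContinuous (D.mutualEnergyMeasure (φ i) (φ j))
      μ.toENNRealVectorMeasure
  memLp_one : ∀ i j, MemLp (fun x => D.Z φ x i j) 1 μ
  memLp_top : ∀ i j, MemLp (fun x => D.Z φ x i j) ∞ μ
  comp_mem : ∀ F ∈ C10 (Set.univ : Set (EuclideanSpace ℝ (Fin m))), F ∘ D.coordMap φ ∈ D.core
  dense : ∀ u ∈ D.core, ∀ ε > 0,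
    ∃ F ∈ C10 (Set.univ : Set (EuclideanSpace ℝ (Fin m))),
      D.energyOne (u - F ∘ D.coordMap φ) < ε

/-- `π ω = ∑ᵢ φⁱ ⊗ (ωᵢ ∘ Φ)` for a 1-form `ω = ∑ᵢ ωᵢ dxⁱ`. -/
def formMap (D : DirichletForm μ) {m : ℕ} (φ : Fin m → D.core)
    (ω : Fin m → EuclideanSpace ℝ (Fin m) → ℝ) : D.H :=
  ∑ i, D.tensor (φ i) (ω i ∘ D.coordMap φ)

/-- The seminorm `‖ω‖_Z = ‖π ω‖_H`. -/
def seminormZ (D : DirichletForm μ) {m : ℕ} (φ : Fin m → D.core)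
    (ω : Fin m → EuclideanSpace ℝ (Fin m) → ℝ) : ℝ :=
  ‖D.formMap φ ω‖

end Algebra

end DirichletForm

end

set_option linter.unusedSectionVars false

noncomputable section

namespace DirichletForm

/-! ### The form on the core, its energy seminorm, and strong locality -/

section CoreForm

variable {K : Type*} [TopologicalSpace K] [MeasurableSpace K] {μ : Measure K}

/-! Composing `Φ` with a bump function equal to `1` on its image puts the constant `1` into the
core, so `K` is compact and `μ` finite; everything then takes place inside C(K).

The engine is strong locality applied to slices. Cutting `f` at equally spaced levels writes it, up
to a constant, as a sum of truncations (`cell`), and each slice is constant where a higher one is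
nonzero, so distinct slices are orthogonal for the form. Hence a combination of slices with
coefficients bounded by `S` has energy norm at most `S` times that of `f`. Piecewise affine
approximation then gives a C¹ calculus in one variable: `ψ ∘ f` stays in the core, and E(ψ∘f, χ∘f)
is a limit of sums in which ψ and χ enter only through ψ'χ' (`tendsto_coreForm_comp`). In particular
the core is an algebra and 4 E(f, f³) = 3 E(f², f²); polarized, this identity says that the carré du
champ is a derivation (`carre_mul_left`).

Positivity of Γ(f, f) also comes from slices: Γ(w, w)(g²) = E(gw, gw) - E(g, gw²), and the sum of w²
over all slices tends to 0 uniformly and in energy as the mesh shrinks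
(`coreCarre_mul_self_nonneg`). Extension of positive functionals and Riesz-Markov produce the energy
measures. Freezing coefficients along a partition of unity makes the form on C ⊗ C positive
semidefinite (`sum_gamma_mul_nonneg`); the norm formula `norm_sum_tensor_sq`, with the densities `Z`
inserted, is claim 1.

For the chain rule, the pairs (u, v) with Γ(u, h) = ∑ vᵢ Γ(φⁱ, h) for all h form a sup-norm closed
subspace `jetSpace`, stable under products and C¹ functions. It contains radial bumps around
arbitrary points, hence their integrals against `F`, that is mollifications, hence `F ∘ Φ` paired
with the pulled-back partial derivatives (`jet_mem`). Claims 2 and 3 follow. For `f` vanishing on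
Φ(K), the relation Γ(f∘Φ, φʲ) = 0 says that the rows of Z_x annihilate df at Φ(x); separability of
C(K)ᵐ provides one null set for all `f`, so the rows lie in the tangent space, and symmetry of `Z`
gives claim 4. -/

lemma energy_eq (D : DirichletForm μ) {f g : K → ℝ} (hf : MemLp f 2 μ)
    (hf' : hf.toLp f ∈ D.domain) (hg : MemLp g 2 μ) (hg' : hg.toLp g ∈ D.domain) :
    D.energy f g = D.form ⟨hf.toLp f, hf'⟩ ⟨hg.toLp g, hg'⟩ := by
  unfold energy
  rw [dif_pos ⟨⟨hf, hf'⟩, ⟨hg, hg'⟩⟩]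

lemma memLp_core {D : DirichletForm μ} (f : D.core) : MemLp f.1 2 μ := f.2.2.2.choose

lemma toLp_core_mem {D : DirichletForm μ} (f : D.core) : (memLp_core f).toLp f.1 ∈ D.domain :=
  f.2.2.2.choose_spec

/-- The map sending an element of the core to its class in the domain. -/
def coreToDomain (D : DirichletForm μ) : D.core →ₗ[ℝ] D.domain where
  toFun f := ⟨(memLp_core f).toLp f.1, toLp_core_mem f⟩
  map_add' f g := Subtype.ext (MemLp.toLp_add (memLp_core f) (memLp_core g))
  map_smul' c f := Subtype.ext (MemLp.toLp_const_smul c (memLp_core f))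

lemma coeFn_coreToDomain (D : DirichletForm μ) (f : D.core) :
    (D.coreToDomain f : Lp ℝ 2 μ) =ᵐ[μ] f.1 :=
  MemLp.coeFn_toLp (memLp_core f)

/-- The Dirichlet form restricted to the core. -/
def coreForm (D : DirichletForm μ) : LinearMap.BilinForm ℝ D.core :=
  D.form.compl₁₂ D.coreToDomain D.coreToDomain

lemma energy_core (D : DirichletForm μ) (f g : D.core) :
    D.energy f.1 g.1 = D.coreForm f g :=
  D.energy_eq (memLp_core f) (toLp_core_mem f) (memLp_core g) (toLp_core_mem g)

lemma coreForm_symm (D : DirichletForm μ) (f g : D.core) : D.coreForm f g = D.coreForm g f :=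
  D.symm _ _

lemma coreForm_nonneg (D : DirichletForm μ) (f : D.core) : 0 ≤ D.coreForm f f :=
  D.nonneg _

lemma coreForm_sq_le (D : DirichletForm μ) (f g : D.core) :
    D.coreForm f g ^ 2 ≤ D.coreForm f f * D.coreForm g g :=
  LinearMap.BilinForm.apply_sq_le_of_symm D.coreForm D.coreForm_nonneg
    ⟨fun f g => D.coreForm_symm f g⟩ f g

/-- The energy seminorm on the core. -/
def energyNorm (D : DirichletForm μ) (f : D.core) : ℝ := √(D.coreForm f f)

lemma energyNorm_nonneg (D : DirichletForm μ) (f : D.core) : 0 ≤ D.energyNorm f :=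
  Real.sqrt_nonneg _

lemma energyNorm_sq (D : DirichletForm μ) (f : D.core) : D.energyNorm f ^ 2 = D.coreForm f f :=
  Real.sq_sqrt (D.coreForm_nonneg f)

lemma abs_coreForm_le (D : DirichletForm μ) (f g : D.core) :
    |D.coreForm f g| ≤ D.energyNorm f * D.energyNorm g := by
  apply abs_le_of_sq_le_sq _ (mul_nonneg (D.energyNorm_nonneg f) (D.energyNorm_nonneg g))
  rw [mul_pow, energyNorm_sq, energyNorm_sq]
  exact D.coreForm_sq_le f g

lemma energyNorm_smul (D : DirichletForm μ) (c : ℝ) (f : D.core) :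
    D.energyNorm (c • f) = |c| * D.energyNorm f := by
  unfold energyNorm
  rw [map_smul, map_smul, LinearMap.smul_apply, smul_eq_mul, smul_eq_mul, ← mul_assoc,
    Real.sqrt_mul (mul_self_nonneg c), Real.sqrt_mul_self_eq_abs]

lemma energyNorm_neg (D : DirichletForm μ) (f : D.core) :
    D.energyNorm (-f) = D.energyNorm f := by
  simp [energyNorm]

lemma energyNorm_add_le (D : DirichletForm μ) (f g : D.core) :
    D.energyNorm (f + g) ≤ D.energyNorm f + D.energyNorm g := by
  apply Real.sqrt_le_iff.2 ⟨add_nonneg (D.energyNorm_nonneg f) (D.energyNorm_nonneg g), ?_⟩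
  have h := le_of_abs_le (D.abs_coreForm_le f g)
  simp only [map_add, LinearMap.add_apply]
  rw [D.coreForm_symm g f, ← D.energyNorm_sq f, ← D.energyNorm_sq g]
  nlinarith

lemma energyNorm_sub_le (D : DirichletForm μ) (f g : D.core) :
    D.energyNorm (f - g) ≤ D.energyNorm f + D.energyNorm g := by
  rw [sub_eq_add_neg, ← D.energyNorm_neg g]
  exact D.energyNorm_add_le f (-g)

/-- Convergence in the energy seminorm implies convergence of the form. -/
lemma tendsto_coreForm {D : DirichletForm μ} {ι : Type*} {l : Filter ι} {u v : ι → D.core}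
    {u₀ v₀ : D.core} (hu : Tendsto (fun n => D.energyNorm (u n - u₀)) l (𝓝 0))
    (hv : Tendsto (fun n => D.energyNorm (v n - v₀)) l (𝓝 0)) :
    Tendsto (fun n => D.coreForm (u n) (v n)) l (𝓝 (D.coreForm u₀ v₀)) := by
  rw [tendsto_iff_norm_sub_tendsto_zero]
  have hlim : Tendsto (fun n => D.energyNorm (u n - u₀) * D.energyNorm (v n - v₀) +
      D.energyNorm (u n - u₀) * D.energyNorm v₀ + D.energyNorm u₀ * D.energyNorm (v n - v₀))
      l (𝓝 0) := by
    simpa using ((hu.mul hv).add (hu.mul_const (D.energyNorm v₀))).add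
      (hv.const_mul (D.energyNorm u₀))
  refine squeeze_zero (fun _ => norm_nonneg _) (fun n => ?_) hlim
  have h1 : D.coreForm (u n) (v n) - D.coreForm u₀ v₀ = D.coreForm (u n - u₀) (v n - v₀) +
      D.coreForm (u n - u₀) v₀ + D.coreForm u₀ (v n - v₀) := by
    simp only [map_sub, LinearMap.sub_apply]; ring
  rw [h1, Real.norm_eq_abs]
  refine (abs_add_three _ _ _).trans ?_
  gcongr <;> exact D.abs_coreForm_le _ _

/-- The form is regular and strongly local, and the constant function `1` lies in its core. -/
class UnitalLocal (D : DirichletForm μ) : Prop where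
  one_mem : (1 : K → ℝ) ∈ D.core
  isStronglyLocal : D.IsStronglyLocal
  isRegular : D.IsRegular

lemma const_mem (D : DirichletForm μ) [D.UnitalLocal] (c : ℝ) : (fun _ => c : K → ℝ) ∈ D.core := by
  have := D.core.smul_mem c (UnitalLocal.one_mem (D := D))
  convert this using 1
  ext x
  simp

/-- Constants as elements of the core. -/
def const (D : DirichletForm μ) [D.UnitalLocal] (c : ℝ) : D.core := ⟨fun _ => c, D.const_mem c⟩

/-- For continuous functions a pointwise condition on {v ≠ 0} is enough: {u = c} is closed and
contains {v ≠ 0}, hence contains the support of |v| μ. -/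
lemma coreForm_eq_zero_of_eq_const [OpensMeasurableSpace K] {D : DirichletForm μ} [D.UnitalLocal]
    {u v : D.core} (c : ℝ)
    (h : ∀ x, v.1 x ≠ 0 → u.1 x = c) : D.coreForm u v = 0 := by
  refine UnitalLocal.isStronglyLocal (D := D) _ _ c ?_
  have hcl : IsClosed {x | u.1 x = c} := isClosed_eq u.2.1 continuous_const
  have hsupp : (μ.withDensity fun y => ‖(D.coreToDomain v : Lp ℝ 2 μ) y‖ₑ).support ⊆
      {x | u.1 x = c} := by
    intro x hx
    by_contra hxc
    have hpos := ((Measure.mem_support_iff_forall x).1 hx) _ (hcl.isOpen_compl.mem_nhds hxc)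
    refine hpos.ne' ?_
    have hae : (fun y => ‖(D.coreToDomain v : Lp ℝ 2 μ) y‖ₑ) =ᵐ[μ] fun y => ‖v.1 y‖ₑ := by
      filter_upwards [D.coeFn_coreToDomain v] with y hy
      rw [hy]
    rw [withDensity_congr_ae hae]
    rw [withDensity_apply_eq_zero v.2.1.measurable.enorm]
    convert measure_empty (μ := μ)
    ext y
    simp only [Set.mem_inter_iff, Set.mem_ofPred_eq, Set.mem_compl_iff, Set.mem_empty_iff_false,
      iff_false, not_and, not_not]
    exact fun hy => h y (by simpa using hy)
  filter_upwards [D.coeFn_coreToDomain u] with x hx hxs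
  rw [hx]
  exact hsupp hxs

end CoreForm

/-! ### Truncations and limits inside the core -/

section Truncation

variable {K : Type*} [TopologicalSpace K] [CompactSpace K] [MeasurableSpace K] [BorelSpace K]
  {μ : Measure K} [IsFiniteMeasure μ]

lemma memLp_of_continuous {f : K → ℝ} (hf : Continuous f) (p : ℝ≥0∞) : MemLp f p μ := by
  exact hf.memLp_of_hasCompactSupport (HasCompactSupport.of_compactSpace f)

lemma mem_core_iff {D : DirichletForm μ} {f : K → ℝ} :
    f ∈ D.core ↔ Continuous f ∧ D.InDomain f :=
  ⟨fun h => ⟨h.1, h.2.2⟩, fun h => ⟨h.1, HasCompactSupport.of_compactSpace f, h.2⟩⟩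

lemma exists_bound (f : K → ℝ) (hf : Continuous f) : ∃ M > 0, ∀ x, |f x| ≤ M := by
  obtain ⟨C, hC⟩ := isCompact_univ.exists_bound_of_continuousOn hf.continuousOn
  exact ⟨max C 1, by positivity, fun x => (hC x trivial).trans (le_max_left _ _)⟩

/-- An affine change of variable turns truncation at `c` into the unit contraction; undoing it needs
the constants to lie in the core. -/
lemma min_const_mem {D : DirichletForm μ} [D.UnitalLocal] (f : D.core) (c : ℝ) :
    (fun x => min (f.1 x) c) ∈ D.core := by
  obtain ⟨M, hM, hf⟩ := exists_bound f.1 f.2.1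
  -- A level strictly below `c` and below all values of `f`, so that dividing by `c - a` is
  -- legitimate and the lower cut-off at 0 is inactive.
  set a : ℝ := -M - |c| - 1 with ha
  have hac : 0 < c - a := by have := neg_abs_le c; rw [ha]; linarith
  obtain ⟨w, hw⟩ : ∃ w : D.core, w = (c - a)⁻¹ • (f - D.const a) := ⟨_, rfl⟩
  obtain ⟨v, hv, -⟩ := D.markov (D.coreToDomain w)
  have hcont : Continuous fun x => min (max 0 (w.1 x)) 1 :=
    (continuous_const.max w.2.1).min continuous_const
  have hmem : (fun x => min (max 0 (w.1 x)) 1) ∈ D.core := by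
    refine mem_core_iff.2 ⟨hcont, memLp_of_continuous hcont 2, ?_⟩
    convert v.2 using 1
    apply Lp.ext
    filter_upwards [MemLp.coeFn_toLp (memLp_of_continuous (μ := μ) hcont 2), hv,
      D.coeFn_coreToDomain w] with x h1 h2 h3
    rw [h1, h2, h3]
  have := (D.const a + (c - a) • (⟨_, hmem⟩ : D.core)).2
  convert this using 1
  ext x
  have hx := abs_le.1 (hf x)
  have hwx : w.1 x = (c - a)⁻¹ * (f.1 x - a) := by rw [hw]; rfl
  have h0 : 0 ≤ w.1 x := by
    rw [hwx]
    have := abs_nonneg c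
    have : 0 ≤ f.1 x - a := by rw [ha]; linarith
    positivity
  change _ = a + (c - a) * min (max 0 (w.1 x)) 1
  rw [max_eq_right h0, hwx, mul_min_of_nonneg _ _ hac.le, mul_inv_cancel_left₀ hac.ne', mul_one,
    ← min_add_add_left]
  simp

/-- The truncation `f ∧ c`. -/
def minConst {D : DirichletForm μ} [D.UnitalLocal] (f : D.core) (c : ℝ) : D.core :=
  ⟨_, min_const_mem f c⟩

/-- A uniform limit of elements of the core that is Cauchy for the energy seminorm is in the core
and is also the limit in the energy seminorm. -/
lemma exists_core_of_tendsto {D : DirichletForm μ} {u : ℕ → D.core} {f : K → ℝ}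
    (hf : ∀ ε > 0, ∃ N, ∀ n ≥ N, ∀ x, |(u n).1 x - f x| ≤ ε)
    (hu : ∀ ε > 0, ∃ N, ∀ k ≥ N, ∀ l ≥ N, D.energyNorm (u k - u l) ≤ ε) :
    ∃ h : f ∈ D.core, Tendsto (fun n => D.energyNorm (u n - ⟨f, h⟩)) atTop (𝓝 0) := by
  have hunif : TendstoUniformly (fun n => (u n).1) f atTop := by
    rw [Metric.tendstoUniformly_iff]
    intro ε hε
    obtain ⟨N, hN⟩ := hf (ε / 2) (by positivity)
    filter_upwards [eventually_ge_atTop N] with n hn x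
    rw [dist_comm, Real.dist_eq]
    linarith [hN n hn x]
  have hcont : Continuous f := hunif.continuous (Frequently.of_forall fun n => (u n).2.1)
  set F : Lp ℝ 2 μ := (memLp_of_continuous hcont 2).toLp f with hF
  have hFae : F =ᵐ[μ] f := MemLp.coeFn_toLp _
  obtain ⟨C, hC0, hC⟩ : ∃ C > 0, ∀ (g : Lp ℝ 2 μ) (M : ℝ), 0 ≤ M → (∀ᵐ x ∂μ, ‖g x‖ ≤ M) →
      ‖g‖ ≤ C * M := by
    -- Adding 1 keeps the constant positive even when `μ` is zero.
    refine ⟨(measureUnivNNReal μ : ℝ) ^ (2 : ℝ≥0∞).toReal⁻¹ + 1, by positivity,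
      fun g M hM hg => (Lp.norm_le_of_ae_bound hM hg).trans ?_⟩
    gcongr
    linarith
  have hLp : Tendsto (fun n => ((D.coreToDomain (u n) : D.domain) : Lp ℝ 2 μ)) atTop (𝓝 F) := by
    rw [Metric.tendsto_atTop]
    intro ε hε
    obtain ⟨N, hN⟩ := hf (ε / (2 * C)) (by positivity)
    refine ⟨N, fun n hn => ?_⟩
    rw [dist_eq_norm]
    have := hC ((D.coreToDomain (u n) : Lp ℝ 2 μ) - F) (ε / (2 * C)) (by positivity) (by
      filter_upwards [D.coeFn_coreToDomain (u n), hFae,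
        Lp.coeFn_sub (D.coreToDomain (u n) : Lp ℝ 2 μ) F] with x h1 h2 h3
      rw [h3, Pi.sub_apply, h1, h2]
      exact hN n hn x)
    have h2 : C * (ε / (2 * C)) = ε / 2 := by field_simp
    linarith
  have hform : ∀ k l, D.form (D.coreToDomain (u k) - D.coreToDomain (u l))
      (D.coreToDomain (u k) - D.coreToDomain (u l)) = D.energyNorm (u k - u l) ^ 2 := by
    intro k l
    rw [energyNorm_sq, ← map_sub]
    rfl
  obtain ⟨v, hv⟩ := D.closed (fun n => D.coreToDomain (u n)) (by
    intro ε hε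
    obtain ⟨N₁, hN₁⟩ := hu (√(ε / 4)) (by positivity)
    obtain ⟨N₂, hN₂⟩ := (Metric.cauchySeq_iff.1 hLp.cauchySeq) (√(ε / 4)) (by positivity)
    refine ⟨max N₁ N₂, fun k hk l hl => ?_⟩
    rw [hform]
    have h1 := hN₁ k (le_of_max_le_left hk) l (le_of_max_le_left hl)
    have h2 := hN₂ k (le_of_max_le_right hk) l (le_of_max_le_right hl)
    rw [dist_eq_norm] at h2
    have h3 : √(ε / 4) ^ 2 = ε / 4 := Real.sq_sqrt (by positivity)
    have h4 := pow_le_pow_left₀ (D.energyNorm_nonneg _) h1 2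
    have h5 := pow_le_pow_left₀ (norm_nonneg _) h2.le 2
    rw [h3] at h4 h5
    have h6 : ‖((D.coreToDomain (u k) - D.coreToDomain (u l) : D.domain) : Lp ℝ 2 μ)‖ =
      ‖(D.coreToDomain (u k) : Lp ℝ 2 μ) - (D.coreToDomain (u l) : Lp ℝ 2 μ)‖ := rfl
    rw [h6]
    linarith)
  -- The limit supplied by closedness is identified through L²: convergence in E₁ and uniform
  -- convergence both imply L² convergence.
  have hvF : (v : Lp ℝ 2 μ) = F := by
    refine tendsto_nhds_unique (f := fun n => (D.coreToDomain (u n) : Lp ℝ 2 μ)) ?_ hLp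
    rw [tendsto_iff_norm_sub_tendsto_zero]
    have h0 : Tendsto (fun n => ‖(D.coreToDomain (u n) : Lp ℝ 2 μ) - v‖ ^ 2) atTop (𝓝 0) :=
      squeeze_zero (fun _ => by positivity)
        (fun n => le_add_of_nonneg_left (D.nonneg (D.coreToDomain (u n) - v))) hv
    have := h0.sqrt
    simpa [Real.sqrt_sq] using this
  have hmem : f ∈ D.core :=
    mem_core_iff.2 ⟨hcont, memLp_of_continuous hcont 2, by rw [← hF, ← hvF]; exact v.2⟩
  refine ⟨hmem, ?_⟩
  have hv' : D.coreToDomain ⟨f, hmem⟩ = v := Subtype.ext (by rw [hvF]; rfl)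
  have h0 : Tendsto (fun n => D.energyNorm (u n - ⟨f, hmem⟩) ^ 2) atTop (𝓝 0) := by
    refine squeeze_zero (fun _ => by positivity) (fun n => ?_) hv
    rw [energyNorm_sq]
    have : D.coreForm (u n - ⟨f, hmem⟩) (u n - ⟨f, hmem⟩) =
        D.form (D.coreToDomain (u n) - v) (D.coreToDomain (u n) - v) := by
      rw [← hv', ← map_sub]; rfl
    rw [this]
    exact le_add_of_nonneg_right (by positivity)
  have := h0.sqrt
  simpa [Real.sqrt_sq, D.energyNorm_nonneg] using this

end Truncation

end DirichletForm

namespace DirichletForm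

/-! ### Slicing by level sets and the C¹ calculus in one variable -/

section Cells

/-- The `k`-th node of the partition of `[a, b]` into `N` intervals of equal length. -/
def node (a b : ℝ) (N k : ℕ) : ℝ := a + (b - a) * (k / N)

lemma node_succ_sub (a b : ℝ) (N k : ℕ) : node a b N (k + 1) - node a b N k = (b - a) / N := by
  unfold node; push_cast; ring

lemma node_zero (a b : ℝ) (N : ℕ) : node a b N 0 = a := by simp [node]

lemma node_self (a b : ℝ) {N : ℕ} (hN : 0 < N) : node a b N N = b := by
  have : (N : ℝ) ≠ 0 := by positivity
  simp [node, this]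

lemma node_mono {a b : ℝ} (hab : a ≤ b) (N : ℕ) {k l : ℕ} (h : k ≤ l) :
    node a b N k ≤ node a b N l := by
  unfold node
  have : 0 ≤ b - a := sub_nonneg.2 hab
  gcongr

lemma node_mem {a b : ℝ} (hab : a ≤ b) {N k : ℕ} (hk : k ≤ N) (hN : 0 < N) :
    node a b N k ∈ Set.Icc a b :=
  ⟨by simpa [node_zero] using node_mono hab N (Nat.zero_le k),
    by simpa [node_self a b hN] using node_mono hab N hk⟩

lemma node_mul (a b : ℝ) {N M : ℕ} (hM : 0 < M) (k : ℕ) :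
    node a b (N * M) (k * M) = node a b N k := by
  have : (M : ℝ) ≠ 0 := by positivity
  unfold node
  push_cast
  rw [mul_div_mul_right _ _ this]

lemma sum_range_mul_eq {G : Type*} [AddCommMonoid G] (g : ℕ → G) (N M : ℕ) :
    ∑ j ∈ Finset.range (N * M), g j =
      ∑ k ∈ Finset.range N, ∑ i ∈ Finset.range M, g (k * M + i) := by
  induction N with
  | zero => simp
  | succ N ih => rw [Finset.sum_range_succ, ← ih, Nat.succ_mul, Finset.sum_range_add]

variable {K : Type*} [TopologicalSpace K] [CompactSpace K] [MeasurableSpace K] [BorelSpace K]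
  {μ : Measure K} [IsFiniteMeasure μ] {D : DirichletForm μ} [D.UnitalLocal]

/-- The part of `f` with values in the `k`-th interval of the partition of `[a, b]`. -/
def cell (f : D.core) (a b : ℝ) (N k : ℕ) : D.core :=
  minConst f (node a b N (k + 1)) - minConst f (node a b N k)

lemma cell_apply (f : D.core) (a b : ℝ) (N k : ℕ) (x : K) :
    (cell f a b N k).1 x = min (f.1 x) (node a b N (k + 1)) - min (f.1 x) (node a b N k) := rfl

lemma cell_nonneg (f : D.core) {a b : ℝ} (hab : a ≤ b) (N k : ℕ) (x : K) :
    0 ≤ (cell f a b N k).1 x := by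
  rw [cell_apply, sub_nonneg]
  exact min_le_min_left _ (node_mono hab N (Nat.le_succ k))

lemma cell_le (f : D.core) {a b : ℝ} (hab : a ≤ b) (N k : ℕ) (x : K) :
    (cell f a b N k).1 x ≤ (b - a) / N := by
  have h1 := node_mono hab N (Nat.le_succ k)
  rw [cell_apply, ← node_succ_sub a b N k]
  rcases le_total (f.1 x) (node a b N k) with h | h
  · rw [min_eq_left (h.trans h1), min_eq_left h]; simpa using h1
  · rw [min_eq_right h]
    linarith [min_le_right (f.1 x) (node a b N (k + 1))]

/-- Where a higher slice is nonzero, `f` exceeds the upper node of every lower slice, so the lower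
slices are full there. -/
lemma cell_eq_of_ne_zero (f : D.core) {a b : ℝ} (hab : a ≤ b) {N i j : ℕ} (hij : i < j) {x : K}
    (hx : (cell f a b N j).1 x ≠ 0) : (cell f a b N i).1 x = (b - a) / N := by
  have h1 : node a b N j < f.1 x := by
    by_contra! h
    rw [cell_apply, min_eq_left h,
      min_eq_left (h.trans (node_mono hab N (Nat.le_succ j))), sub_self] at hx
    exact hx rfl
  have h2 := node_mono hab N (Nat.succ_le_of_lt hij)
  have h3 := node_mono hab N (Nat.le_succ i)
  simp only [Nat.succ_eq_add_one] at h2 h3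
  rw [cell_apply, min_eq_right (h2.trans h1.le), min_eq_right (h3.trans (h2.trans h1.le)),
    node_succ_sub]

lemma coreForm_cell_of_ne (f : D.core) {a b : ℝ} (hab : a ≤ b) {N i j : ℕ} (hij : i ≠ j) :
    D.coreForm (cell f a b N i) (cell f a b N j) = 0 := by
  rcases hij.lt_or_gt with h | h
  · exact coreForm_eq_zero_of_eq_const _ fun x hx => cell_eq_of_ne_zero f hab h hx
  · rw [coreForm_symm]
    exact coreForm_eq_zero_of_eq_const _ fun x hx => cell_eq_of_ne_zero f hab h hx

lemma coreForm_sum_smul_cell (f : D.core) {a b : ℝ} (hab : a ≤ b) (N : ℕ) (s t : ℕ → ℝ) :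
    D.coreForm (∑ k ∈ Finset.range N, s k • cell f a b N k)
      (∑ k ∈ Finset.range N, t k • cell f a b N k) =
    ∑ k ∈ Finset.range N, s k * t k * D.coreForm (cell f a b N k) (cell f a b N k) := by
  rw [map_sum]
  refine Finset.sum_congr rfl fun i hi => ?_
  rw [map_sum, LinearMap.sum_apply, Finset.sum_eq_single i]
  · simp only [map_smul, LinearMap.smul_apply, smul_eq_mul]; ring
  · intro j _ hj
    simp [coreForm_cell_of_ne f hab hj]
  · exact fun h => absurd hi h

lemma coreForm_const_left (c : ℝ) (f : D.core) : D.coreForm (D.const c) f = 0 :=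
  coreForm_eq_zero_of_eq_const c fun _ _ => rfl

lemma coreForm_const_right (c : ℝ) (f : D.core) : D.coreForm f (D.const c) = 0 := by
  rw [coreForm_symm, coreForm_const_left]

lemma sum_cell (f : D.core) {a b : ℝ} {N : ℕ} (hN : 0 < N)
    (hf : ∀ x, f.1 x ∈ Set.Icc a b) : ∑ k ∈ Finset.range N, cell f a b N k = f - D.const a := by
  unfold cell
  rw [Finset.sum_range_sub (fun k => minConst f (node a b N k)), node_zero, node_self a b hN]
  ext x
  change min (f.1 x) b - min (f.1 x) a = f.1 x - a
  rw [min_eq_left (hf x).2, min_eq_right (hf x).1]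

lemma sum_coreForm_cell (f : D.core) {a b : ℝ} (hab : a ≤ b) {N : ℕ} (hN : 0 < N)
    (hf : ∀ x, f.1 x ∈ Set.Icc a b) :
    ∑ k ∈ Finset.range N, D.coreForm (cell f a b N k) (cell f a b N k) = D.coreForm f f := by
  have h := coreForm_sum_smul_cell f hab N (fun _ => 1) (fun _ => 1)
  simp only [one_smul, one_mul, sum_cell f hN hf] at h
  rw [← h]
  simp [coreForm_const_left, coreForm_const_right]

/-- Pythagoras: the slices are orthogonal and their energies add up to that of `f`. -/
lemma energyNorm_sum_smul_cell_le (f : D.core) {a b : ℝ} (hab : a ≤ b) {N : ℕ} (hN : 0 < N)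
    (hf : ∀ x, f.1 x ∈ Set.Icc a b) (s : ℕ → ℝ) {S : ℝ} (hS : 0 ≤ S)
    (hs : ∀ k < N, |s k| ≤ S) :
    D.energyNorm (∑ k ∈ Finset.range N, s k • cell f a b N k) ≤ S * D.energyNorm f := by
  apply Real.sqrt_le_iff.2 ⟨mul_nonneg hS (D.energyNorm_nonneg f), ?_⟩
  rw [coreForm_sum_smul_cell f hab, mul_pow, energyNorm_sq, ← sum_coreForm_cell f hab hN hf,
    Finset.mul_sum]
  refine Finset.sum_le_sum fun k hk => ?_
  have h1 := hs k (Finset.mem_range.1 hk)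
  have h2 := D.coreForm_nonneg (cell f a b N k)
  have h3 : s k * s k ≤ S ^ 2 := by
    rw [← abs_mul_abs_self, sq]
    exact mul_self_le_mul_self (abs_nonneg _) h1
  gcongr

lemma cell_eq_sum (f : D.core) (a b : ℝ) (N k : ℕ) {M : ℕ} (hM : 0 < M) :
    cell f a b N k = ∑ i ∈ Finset.range M, cell f a b (N * M) (k * M + i) := by
  unfold cell
  have := Finset.sum_range_sub (fun i => minConst f (node a b (N * M) (k * M + i))) M
  simp only [← add_assoc] at this
  rw [this, add_zero, node_mul a b hM, ← node_mul a b hM (k + 1), Nat.succ_mul]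

/-- The function `ψ ∘ f` with `ψ` replaced by a piecewise affine function. -/
def approx (ψ ψ' : ℝ → ℝ) (f : D.core) (a b : ℝ) (N : ℕ) : D.core :=
  D.const (ψ a) + ∑ k ∈ Finset.range N, ψ' (node a b N k) • cell f a b N k

lemma coe_sum_core {ι : Type*} (s : Finset ι) (f : ι → D.core) (x : K) :
    (∑ i ∈ s, f i).1 x = ∑ i ∈ s, (f i).1 x := by
  rw [Submodule.coe_sum, Finset.sum_apply]

/-- Both functions agree at level `a`; on each slice the mean value theorem replaces the increment
of `ψ` by a value of `ψ'` within one mesh length of the node, and the increments of `min t (node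
..)` telescope. -/
lemma abs_approx_sub_le {ψ ψ' : ℝ → ℝ} {a b : ℝ} (hab : a ≤ b)
    (hψ : ∀ t ∈ Set.Icc a b, HasDerivAt ψ (ψ' t) t) {N : ℕ} (hN : 0 < N) {ε : ℝ}
    (hε : ∀ s ∈ Set.Icc a b, ∀ t ∈ Set.Icc a b, |s - t| ≤ (b - a) / N → |ψ' s - ψ' t| ≤ ε)
    (f : D.core) {x : K} (hf : f.1 x ∈ Set.Icc a b) :
    |(approx ψ ψ' f a b N).1 x - ψ (f.1 x)| ≤ ε * (b - a) := by
  set t := f.1 x with ht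
  have hε0 : 0 ≤ ε := by
    have := hε a ⟨le_rfl, hab⟩ a ⟨le_rfl, hab⟩ (by
      rw [sub_self, abs_zero]; have := sub_nonneg.2 hab; positivity)
    simpa using this
  have h1 : ψ t = ψ a + ∑ k ∈ Finset.range N,
      (ψ (min t (node a b N (k + 1))) - ψ (min t (node a b N k))) := by
    rw [Finset.sum_range_sub (fun k => ψ (min t (node a b N k))), node_zero, node_self a b hN,
      min_eq_left hf.2, min_eq_right hf.1]
    ring
  have h2 : (approx ψ ψ' f a b N).1 x = ψ a + ∑ k ∈ Finset.range N,
      ψ' (node a b N k) * (min t (node a b N (k + 1)) - min t (node a b N k)) := by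
    change ψ a + (∑ k ∈ Finset.range N, ψ' (node a b N k) • cell f a b N k).1 x = _
    rw [coe_sum_core]
    rfl
  have h3 : ∑ k ∈ Finset.range N, (min t (node a b N (k + 1)) - min t (node a b N k)) = t - a := by
    rw [Finset.sum_range_sub (fun k => min t (node a b N k)), node_zero, node_self a b hN,
      min_eq_left hf.2, min_eq_right hf.1]
  rw [h1, h2, add_sub_add_left_eq_sub, ← Finset.sum_sub_distrib]
  refine (Finset.abs_sum_le_sum_abs _ _).trans ?_
  calc _ ≤ ∑ k ∈ Finset.range N, ε * (min t (node a b N (k + 1)) - min t (node a b N k)) := by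
        refine Finset.sum_le_sum fun k hk => ?_
        have hk := Finset.mem_range.1 hk
        have hn := node_mono hab N (Nat.le_succ k)
        have hk0 := node_mem (k := k) hab hk.le hN
        have hk1 := node_mem (k := k + 1) hab hk hN
        have hle : min t (node a b N k) ≤ min t (node a b N (k + 1)) := min_le_min_left _ hn
        -- Either slice `k` vanishes at this point or the value `t` lies above node `k`.
        rcases hle.eq_or_lt with he | hlt
        · rw [he]; simp
        · have hp : min t (node a b N k) = node a b N k := by
            refine min_eq_right ?_
            by_contra! hlt'
            rw [min_eq_left hlt'.le, min_eq_left (hlt'.le.trans hn)] at hlt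
            exact lt_irrefl _ hlt
          rw [hp] at hlt ⊢
          have hq := min_le_right t (node a b N (k + 1))
          obtain ⟨c, hc, hc'⟩ := exists_hasDerivAt_eq_slope ψ ψ' hlt
            (fun s hs => (hψ s ⟨hk0.1.trans hs.1, hs.2.trans (hq.trans hk1.2)⟩).continuousAt.continuousWithinAt)
            (fun s hs => hψ s ⟨hk0.1.trans hs.1.le, hs.2.le.trans (hq.trans hk1.2)⟩)
          have hpos := sub_pos.2 hlt
          rw [eq_div_iff hpos.ne'] at hc'
          rw [← hc', ← sub_mul, abs_mul, abs_of_pos hpos]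
          refine mul_le_mul_of_nonneg_right ?_ hpos.le
          refine hε _ hk0 c ⟨hk0.1.trans hc.1.le, hc.2.le.trans (hq.trans hk1.2)⟩ ?_
          rw [abs_sub_comm, abs_of_pos (sub_pos.2 hc.1), ← node_succ_sub a b N k]
          linarith [hc.2]
    _ = ε * (t - a) := by rw [← Finset.mul_sum, h3]
    _ ≤ ε * (b - a) := by gcongr; exact hf.2

/-- On the refined partition the difference is a combination of fine slices whose coefficients are
differences of `ψ'` at points at most one coarse mesh length apart, so Pythagoras applies. -/
lemma energyNorm_approx_sub_le {ψ ψ' : ℝ → ℝ} {a b : ℝ} (hab : a ≤ b) {N M : ℕ} (hN : 0 < N)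
    (hM : 0 < M) {ε : ℝ}
    (hε : ∀ s ∈ Set.Icc a b, ∀ t ∈ Set.Icc a b, |s - t| ≤ (b - a) / N → |ψ' s - ψ' t| ≤ ε)
    (f : D.core) (hf : ∀ x, f.1 x ∈ Set.Icc a b) :
    D.energyNorm (approx ψ ψ' f a b N - approx ψ ψ' f a b (N * M)) ≤ ε * D.energyNorm f := by
  have hba := sub_nonneg.2 hab
  have hε0 : 0 ≤ ε := by
    have := hε a ⟨le_rfl, hab⟩ a ⟨le_rfl, hab⟩ (by rw [sub_self, abs_zero]; positivity)
    simpa using this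
  have hNM : 0 < N * M := Nat.mul_pos hN hM
  -- The coarse slice containing the fine slice `j` has index `j / M`.
  have h1 : ∑ k ∈ Finset.range N, ψ' (node a b N k) • cell f a b N k =
      ∑ j ∈ Finset.range (N * M), ψ' (node a b N (j / M)) • cell f a b (N * M) j := by
    rw [sum_range_mul_eq]
    refine Finset.sum_congr rfl fun k _ => ?_
    rw [cell_eq_sum f a b N k hM, Finset.smul_sum]
    refine Finset.sum_congr rfl fun i hi => ?_
    rw [mul_comm k M, Nat.mul_add_div hM, Nat.div_eq_of_lt (Finset.mem_range.1 hi), add_zero]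
  unfold approx
  rw [h1, add_sub_add_left_eq_sub, ← Finset.sum_sub_distrib]
  rw [Finset.sum_congr rfl fun j _ => (sub_smul (ψ' (node a b N (j / M)))
    (ψ' (node a b (N * M) j)) (cell f a b (N * M) j)).symm]
  refine energyNorm_sum_smul_cell_le f hab hNM hf _ hε0 fun j hj => ?_
  have hjM : j / M < N := Nat.div_lt_of_lt_mul (by rwa [mul_comm])
  refine hε _ (node_mem hab hjM.le hN) _ (node_mem hab hj.le hNM) ?_
  have e1 := node_mul a b (N := N) hM (j / M)
  have e2 := node_mul a b (N := N) hM (j / M + 1)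
  have l1 := node_mono hab (N * M) (Nat.div_mul_le_self j M)
  have l2 := node_mono hab (N * M) (Nat.lt_div_mul_add (a := j) hM).le
  rw [← Nat.succ_mul, Nat.succ_eq_add_one, e2] at l2
  rw [e1] at l1
  rw [abs_sub_comm, abs_of_nonneg (sub_nonneg.2 l1), ← node_succ_sub a b N (j / M)]
  linarith

lemma exists_modulus {ψ' : ℝ → ℝ} {a b : ℝ} (hψ' : ContinuousOn ψ' (Set.Icc a b))
    {ε : ℝ} (hε : 0 < ε) :
    ∃ N₀ : ℕ, ∀ n ≥ N₀, ∀ s ∈ Set.Icc a b, ∀ t ∈ Set.Icc a b,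
      |s - t| ≤ (b - a) / ((n + 1 : ℕ) : ℝ) → |ψ' s - ψ' t| ≤ ε := by
  have hu := isCompact_Icc.uniformContinuousOn_of_continuous hψ'
  rw [Metric.uniformContinuousOn_iff] at hu
  obtain ⟨δ, hδ, h⟩ := hu ε hε
  have hlim : Tendsto (fun n : ℕ => (b - a) / ((n + 1 : ℕ) : ℝ)) atTop (𝓝 0) :=
    (tendsto_const_div_atTop_nhds_zero_nat (b - a)).comp (tendsto_add_atTop_nat 1)
  obtain ⟨N₀, hN₀⟩ := eventually_atTop.1 (hlim.eventually (gt_mem_nhds hδ))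
  exact ⟨N₀, fun n hn s hs t ht hst => (h s hs t ht (hst.trans_lt (hN₀ n hn))).le⟩

/-- The piecewise affine approximations converge uniformly and are Cauchy in energy, so closedness
of the form applies. -/
lemma exists_comp_mem_core {ψ ψ' : ℝ → ℝ} {a b : ℝ} (hab : a ≤ b)
    (hψ : ∀ t ∈ Set.Icc a b, HasDerivAt ψ (ψ' t) t) (hψ' : ContinuousOn ψ' (Set.Icc a b))
    (f : D.core) (hf : ∀ x, f.1 x ∈ Set.Icc a b) :
    ∃ h : ψ ∘ f.1 ∈ D.core,
      Tendsto (fun n => D.energyNorm (approx ψ ψ' f a b (n + 1) - ⟨ψ ∘ f.1, h⟩)) atTop (𝓝 0) := by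
  have hba := sub_nonneg.2 hab
  have he := D.energyNorm_nonneg f
  refine exists_core_of_tendsto ?_ ?_
  · intro ε hε
    obtain ⟨N, hN⟩ := exists_modulus hψ' (ε := ε / (b - a + 1)) (by positivity)
    refine ⟨N, fun n hn x => ?_⟩
    refine (abs_approx_sub_le hab hψ n.succ_pos (hN n hn) f (hf x)).trans ?_
    rw [div_mul_eq_mul_div, div_le_iff₀ (by positivity)]
    nlinarith
  · intro ε hε
    obtain ⟨N, hN⟩ := exists_modulus hψ' (ε := ε / (2 * (D.energyNorm f + 1))) (by positivity)
    refine ⟨N, fun k hk l hl => ?_⟩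
    -- Two meshes are compared through their common refinement into `(k + 1) * (l + 1)` intervals.
    have h1 := energyNorm_approx_sub_le (ψ := ψ) hab k.succ_pos l.succ_pos (hN k hk) f hf
    have h2 := energyNorm_approx_sub_le (ψ := ψ) hab l.succ_pos k.succ_pos (hN l hl) f hf
    rw [Nat.succ_eq_add_one, Nat.succ_eq_add_one, mul_comm (l + 1)] at h2
    have h3 := D.energyNorm_sub_le
      (approx ψ ψ' f a b (k + 1) - approx ψ ψ' f a b ((k + 1) * (l + 1)))
      (approx ψ ψ' f a b (l + 1) - approx ψ ψ' f a b ((k + 1) * (l + 1)))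
    rw [sub_sub_sub_cancel_right] at h3
    have h4 : ε / (2 * (D.energyNorm f + 1)) * D.energyNorm f ≤ ε / 2 := by
      rw [div_mul_eq_mul_div, div_le_div_iff₀ (by positivity) (by positivity)]
      nlinarith
    linarith

lemma comp_mem_core {ψ ψ' : ℝ → ℝ} {a b : ℝ} (hab : a ≤ b)
    (hψ : ∀ t ∈ Set.Icc a b, HasDerivAt ψ (ψ' t) t) (hψ' : ContinuousOn ψ' (Set.Icc a b))
    (f : D.core) (hf : ∀ x, f.1 x ∈ Set.Icc a b) : ψ ∘ f.1 ∈ D.core :=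
  (exists_comp_mem_core hab hψ hψ' f hf).choose

/-- The slice energies in these sums do not depend on ψ and χ, so a pointwise identity between
products of derivatives yields an identity between energies. -/
lemma tendsto_coreForm_comp {ψ ψ' χ χ' : ℝ → ℝ} {a b : ℝ} (hab : a ≤ b)
    (hψ : ∀ t ∈ Set.Icc a b, HasDerivAt ψ (ψ' t) t) (hψ' : ContinuousOn ψ' (Set.Icc a b))
    (hχ : ∀ t ∈ Set.Icc a b, HasDerivAt χ (χ' t) t) (hχ' : ContinuousOn χ' (Set.Icc a b))
    (f : D.core) (hf : ∀ x, f.1 x ∈ Set.Icc a b) (h₁ : ψ ∘ f.1 ∈ D.core) (h₂ : χ ∘ f.1 ∈ D.core) :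
    Tendsto (fun n => ∑ k ∈ Finset.range (n + 1), ψ' (node a b (n + 1) k) *
      χ' (node a b (n + 1) k) * D.coreForm (cell f a b (n + 1) k) (cell f a b (n + 1) k))
      atTop (𝓝 (D.coreForm ⟨ψ ∘ f.1, h₁⟩ ⟨χ ∘ f.1, h₂⟩)) := by
  refine (tendsto_coreForm (exists_comp_mem_core hab hψ hψ' f hf).choose_spec
    (exists_comp_mem_core hab hχ hχ' f hf).choose_spec).congr fun n => ?_
  unfold approx
  rw [← coreForm_sum_smul_cell f hab]
  simp only [map_add, LinearMap.add_apply, coreForm_const_left, coreForm_const_right, zero_add]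

lemma energyNorm_comp_le {ψ ψ' : ℝ → ℝ} {a b : ℝ} (hab : a ≤ b)
    (hψ : ∀ t ∈ Set.Icc a b, HasDerivAt ψ (ψ' t) t) (hψ' : ContinuousOn ψ' (Set.Icc a b))
    (f : D.core) (hf : ∀ x, f.1 x ∈ Set.Icc a b) (h₁ : ψ ∘ f.1 ∈ D.core) {S : ℝ}
    (hS : ∀ t ∈ Set.Icc a b, |ψ' t| ≤ S) :
    D.energyNorm ⟨ψ ∘ f.1, h₁⟩ ≤ S * D.energyNorm f := by
  have hS0 : 0 ≤ S := (abs_nonneg _).trans (hS a ⟨le_rfl, hab⟩)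
  have hlim := (tendsto_coreForm_comp hab hψ hψ' hψ hψ' f hf h₁ h₁).sqrt
  refine le_of_tendsto' hlim fun n => ?_
  rw [← coreForm_sum_smul_cell f hab]
  exact energyNorm_sum_smul_cell_le f hab n.succ_pos hf _ hS0
    fun k hk => hS _ (node_mem hab hk.le n.succ_pos)

end Cells

end DirichletForm

/-! ### Algebra: a quartic identity equivalent to the Leibniz rule -/

section CarreDuChamp

variable {A : Type*} [CommRing A] [Algebra ℝ A] (B : LinearMap.BilinForm ℝ A)

/-- The trilinear form `(f, g, φ) ↦ ½ (B(φ f, g) + B(φ g, f) - B(φ, f g))`. -/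
def carre : A →ₗ[ℝ] A →ₗ[ℝ] A →ₗ[ℝ] ℝ :=
  LinearMap.mk₂ ℝ
    (fun f g =>
      { toFun := fun φ => (B (φ * f) g + B (φ * g) f - B φ (f * g)) / 2
        map_add' := fun φ ψ => by simp only [add_mul, map_add, LinearMap.add_apply]; ring
        map_smul' := fun c φ => by
          simp only [smul_mul_assoc, map_smul, LinearMap.smul_apply, smul_eq_mul,
            RingHom.id_apply]
          ring })
    (fun f f' g => by
      ext φ
      simp only [LinearMap.coe_mk, AddHom.coe_mk, LinearMap.add_apply, add_mul, mul_add, map_add]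
      ring)
    (fun c f g => by
      ext φ
      simp only [LinearMap.coe_mk, AddHom.coe_mk, LinearMap.smul_apply, smul_mul_assoc,
        mul_smul_comm, map_smul, smul_eq_mul]
      ring)
    (fun f g g' => by
      ext φ
      simp only [LinearMap.coe_mk, AddHom.coe_mk, LinearMap.add_apply, mul_add, map_add]
      ring)
    (fun c f g => by
      ext φ
      simp only [LinearMap.coe_mk, AddHom.coe_mk, LinearMap.smul_apply, mul_smul_comm, map_smul,
        smul_eq_mul]
      ring)

lemma carre_apply (f g φ : A) :
    carre B f g φ = (B (φ * f) g + B (φ * g) f - B φ (f * g)) / 2 := rfl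

lemma carre_comm (f g φ : A) : carre B f g φ = carre B g f φ := by
  rw [carre_apply, carre_apply, mul_comm f g]; ring

/-- The symmetric quadrilinear form that vanishes if and only if `carre B` is a derivation. -/
def quartic (a b c d : A) : ℝ :=
  B a (b * c * d) + B b (a * c * d) + B c (a * b * d) + B d (a * b * c) -
    B (a * b) (c * d) - B (a * c) (b * d) - B (a * d) (b * c)

variable {B}

lemma quartic_add (a a' b c d : A) :
    quartic B (a + a') b c d = quartic B a b c d + quartic B a' b c d := by
  simp only [quartic, add_mul, map_add, LinearMap.add_apply]
  ring

lemma quartic_neg (a b c d : A) : quartic B (-a) b c d = -quartic B a b c d := by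
  simp only [quartic, neg_mul, map_neg, LinearMap.neg_apply]
  ring

lemma quartic_swap₁₂ (hB : ∀ a b, B a b = B b a) (a b c d : A) :
    quartic B a b c d = quartic B b a c d := by
  simp only [quartic]
  rw [hB (b * c) (a * d), hB (b * d) (a * c), mul_comm b a]
  ring

lemma quartic_swap₂₃ (a b c d : A) : quartic B a b c d = quartic B a c b d := by
  simp only [quartic]
  rw [mul_comm c b, mul_right_comm a c b]
  ring

lemma quartic_swap₃₄ (a b c d : A) : quartic B a b c d = quartic B a b d c := by
  simp only [quartic]
  rw [mul_comm d c, mul_right_comm b d c, mul_right_comm a d c]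
  ring

/-- Polarization of a symmetric quadrilinear form that vanishes on the diagonal. -/
lemma quartic_eq_zero (hB : ∀ a b, B a b = B b a) (hq : ∀ a, quartic B a a a a = 0)
    (a b c d : A) : quartic B a b c d = 0 := by
  have add₂ : ∀ a b b' c d, quartic B a (b + b') c d = quartic B a b c d + quartic B a b' c d := by
    intro a b b' c d
    rw [quartic_swap₁₂ hB, quartic_add, quartic_swap₁₂ hB b, quartic_swap₁₂ hB b']
  have add₃ : ∀ a b c c' d, quartic B a b (c + c') d = quartic B a b c d + quartic B a b c' d := by
    intro a b c c' d
    rw [quartic_swap₂₃, add₂, quartic_swap₂₃ a c, quartic_swap₂₃ a c']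
  have add₄ : ∀ a b c d d', quartic B a b c (d + d') = quartic B a b c d + quartic B a b c d' := by
    intro a b c d d'
    rw [quartic_swap₃₄, add₃, quartic_swap₃₄ a b d, quartic_swap₃₄ a b d']
  have neg₂ : ∀ a b c d, quartic B a (-b) c d = -quartic B a b c d := by
    intro a b c d
    rw [quartic_swap₁₂ hB, quartic_neg, quartic_swap₁₂ hB b]
  have neg₃ : ∀ a b c d, quartic B a b (-c) d = -quartic B a b c d := by
    intro a b c d
    rw [quartic_swap₂₃, neg₂, quartic_swap₂₃ a c]
  have neg₄ : ∀ a b c d, quartic B a b c (-d) = -quartic B a b c d := by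
    intro a b c d
    rw [quartic_swap₃₄, neg₃, quartic_swap₃₄ a b d]
  have h22 : ∀ a b, quartic B a a b b = 0 := by
    intro a b
    -- Adding the expansions at `a + b` and `a - b` cancels the odd terms and leaves twelve copies
    -- of the value at `(a, a, b, b)`.
    have h1 := hq (a + b)
    have h2 := hq (a + -b)
    simp only [quartic_add, add₂, add₃, add₄, quartic_neg, neg₂, neg₃, neg₄, hq] at h1 h2
    have e1 : quartic B b b a a = quartic B a a b b := by
      rw [quartic_swap₂₃, quartic_swap₁₂ hB, quartic_swap₃₄, quartic_swap₂₃]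
    have e2 : quartic B a b a b = quartic B a a b b := quartic_swap₂₃ _ _ _ _
    have e3 : quartic B a b b a = quartic B a a b b := by rw [quartic_swap₃₄, e2]
    have e4 : quartic B b a a b = quartic B a a b b := by rw [quartic_swap₁₂ hB, e2]
    have e5 : quartic B b a b a = quartic B a a b b := by rw [quartic_swap₁₂ hB, e3]
    rw [e1, e2, e3, e4, e5] at h1 h2
    linarith
  have h12 : ∀ a c b, quartic B a c b b = 0 := by
    intro a c b
    have h := h22 (a + c) b
    rw [quartic_add, add₂, add₂, h22, h22, quartic_swap₁₂ hB c] at h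
    linarith
  have h := h12 a b (c + d)
  rw [add₃, add₄, add₄, h12, h12, quartic_swap₃₄ a b d] at h
  linarith

/-- After symmetry of `B` is applied, the defect in the Leibniz rule is, up to a constant factor,
`quartic B φ f g h`. -/
lemma carre_mul_left (hB : ∀ a b, B a b = B b a) (hq : ∀ a, quartic B a a a a = 0)
    (f g h φ : A) : carre B (f * g) h φ = carre B g h (φ * f) + carre B f h (φ * g) := by
  have h0 := quartic_eq_zero hB hq φ f g h
  simp only [quartic] at h0
  simp only [carre_apply]
  have e1 : φ * f * h = φ * h * f := by ring
  have e2 : B (φ * f * h) g = B g (φ * f * h) := hB _ _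
  have e3 : B (φ * g * h) f = B f (φ * g * h) := hB _ _
  have e4 : B (φ * h) (f * g) = B (φ * h) (f * g) := rfl
  have e5 : φ * g * f = φ * f * g := by ring
  have e6 : B (φ * f * g) h = B h (φ * f * g) := hB _ _
  have e7 : B (φ * g) (f * h) = B (φ * g) (f * h) := rfl
  rw [← mul_assoc φ f g, e2, e3, e5, e6]
  linarith

/-- This is the quartic identity at `(g, g, w, w)`. It isolates a nonnegative term and a term linear
in w², which becomes small when summed over slices. -/
lemma carre_mul_self_mul_self (hB : ∀ a b, B a b = B b a) (hq : ∀ a, quartic B a a a a = 0)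
    (g w : A) : carre B w w (g * g) = B (g * w) (g * w) - B g (g * (w * w)) := by
  have h0 := quartic_eq_zero hB hq g g w w
  simp only [quartic, ← mul_assoc] at h0 ⊢
  rw [carre_apply, hB (g * g * w) w]
  linarith

end CarreDuChamp

namespace DirichletForm

/-! ### The core as an algebra -/

section Ring

variable {K : Type*} [TopologicalSpace K] [CompactSpace K] [MeasurableSpace K] [BorelSpace K]
  {μ : Measure K} [IsFiniteMeasure μ] {D : DirichletForm μ} [D.UnitalLocal]

lemma sq_mem_core (f : D.core) : (fun s => s ^ 2) ∘ f.1 ∈ D.core := by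
  obtain ⟨M, hM, hf⟩ := exists_bound f.1 f.2.1
  exact comp_mem_core (ψ' := fun s => 2 * s) (a := -M) (b := M) (by linarith)
    (fun t _ => by simpa using hasDerivAt_pow 2 t) (by fun_prop) f fun x => abs_le.1 (hf x)

lemma mul_mem_core (f g : D.core) : f.1 * g.1 ∈ D.core := by
  have h := D.core.smul_mem (1 / 4)
    (D.core.sub_mem (sq_mem_core (f + g)) (sq_mem_core (f - g)))
  convert h using 1
  ext x
  change f.1 x * g.1 x = 1 / 4 * ((f.1 x + g.1 x) ^ 2 - (f.1 x - g.1 x) ^ 2)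
  ring

instance : CommRing D.core :=
  { (inferInstance : AddCommGroup D.core) with
    mul := fun f g => ⟨f.1 * g.1, mul_mem_core f g⟩
    one := ⟨1, UnitalLocal.one_mem⟩
    left_distrib := fun f g h => Subtype.ext (mul_add f.1 g.1 h.1)
    right_distrib := fun f g h => Subtype.ext (add_mul f.1 g.1 h.1)
    zero_mul := fun f => Subtype.ext (zero_mul f.1)
    mul_zero := fun f => Subtype.ext (mul_zero f.1)
    mul_assoc := fun f g h => Subtype.ext (mul_assoc f.1 g.1 h.1)
    one_mul := fun f => Subtype.ext (one_mul f.1)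
    mul_one := fun f => Subtype.ext (mul_one f.1)
    mul_comm := fun f g => Subtype.ext (mul_comm f.1 g.1) }

instance : Algebra ℝ D.core :=
  Algebra.ofModule (fun c f g => Subtype.ext (smul_mul_assoc c f.1 g.1))
    (fun c f g => Subtype.ext (mul_smul_comm c f.1 g.1))

@[simp] lemma coe_mul_core (f g : D.core) : (f * g).1 = f.1 * g.1 := rfl

@[simp] lemma coe_one_core : (1 : D.core).1 = 1 := rfl

lemma coreForm_one_left (f : D.core) : D.coreForm 1 f = 0 := coreForm_const_left 1 f

lemma hasDerivAt_mul_self (t : ℝ) : HasDerivAt (fun s : ℝ => s * s) (2 * t) t :=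
  ((hasDerivAt_id' t).fun_mul (hasDerivAt_id' t)).congr_deriv (by ring)

/-- On the diagonal the claim is 4 E(f, f³) = 3 E(f², f²), which the calculus reduces to 4 · 1 · 3t²
= 3 · (2t)². -/
lemma quartic_coreForm (f : D.core) : quartic D.coreForm f f f f = 0 := by
  obtain ⟨M, hM, hf⟩ := exists_bound f.1 f.2.1
  have hMM : -M ≤ M := by linarith
  have hf' : ∀ x, f.1 x ∈ Set.Icc (-M) M := fun x => abs_le.1 (hf x)
  have d1 : ∀ t ∈ Set.Icc (-M) M, HasDerivAt (fun s : ℝ => s) ((fun _ => 1) t) t :=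
    fun t _ => hasDerivAt_id t
  have d2 : ∀ t ∈ Set.Icc (-M) M, HasDerivAt (fun s : ℝ => s * s) ((fun s => 2 * s) t) t :=
    fun t _ => hasDerivAt_mul_self t
  have d3 : ∀ t ∈ Set.Icc (-M) M, HasDerivAt (fun s : ℝ => s * s * s)
      ((fun s => 3 * (s * s)) t) t :=
    fun t ht => ((d2 t ht).fun_mul (hasDerivAt_id' t)).congr_deriv (by ring)
  have l1 := tendsto_coreForm_comp hMM d1 (by fun_prop) d3 (by fun_prop) f hf' f.2 (f * f * f).2
  have l2 := tendsto_coreForm_comp hMM d2 (by fun_prop) d2 (by fun_prop) f hf' (f * f).2 (f * f).2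
  have l3 := (l1.const_mul 4).sub (l2.const_mul 3)
  have l4 := tendsto_nhds_unique l3 (tendsto_const_nhds (x := (0 : ℝ)) |>.congr fun n => by
    rw [Finset.mul_sum, Finset.mul_sum, ← Finset.sum_sub_distrib]
    refine (Finset.sum_eq_zero fun k _ => ?_).symm
    ring)
  change 4 * D.coreForm f (f * f * f) - 3 * D.coreForm (f * f) (f * f) = 0 at l4
  simp only [quartic]
  linarith

lemma energyNorm_mul_self_le (f : D.core) {M : ℝ} (hM : 0 ≤ M) (hf : ∀ x, |f.1 x| ≤ M) :
    D.energyNorm (f * f) ≤ 2 * M * D.energyNorm f := by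
  refine energyNorm_comp_le (ψ := fun s => s * s) (ψ' := fun s => 2 * s) (a := -M) (b := M)
    (by linarith) (fun t _ => hasDerivAt_mul_self t)
    (by fun_prop) f (fun x => abs_le.1 (hf x)) (f * f).2 fun t ht => ?_
  rw [abs_mul, abs_two]
  gcongr
  exact abs_le.2 ht

/-- Rescaling both factors to sup norm at most 1 before polarizing makes the bound weight each
energy by the sup bound of the other factor; without this weighting a uniformly small factor would
not give a small product. -/
lemma energyNorm_mul_le (f g : D.core) {F G : ℝ} (hF : 0 < F) (hG : 0 < G)
    (hf : ∀ x, |f.1 x| ≤ F) (hg : ∀ x, |g.1 x| ≤ G) :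
    D.energyNorm (f * g) ≤ 2 * (G * D.energyNorm f + F * D.energyNorm g) := by
  obtain ⟨f', hf'⟩ : ∃ f' : D.core, f' = F⁻¹ • f := ⟨_, rfl⟩
  obtain ⟨g', hg'⟩ : ∃ g' : D.core, g' = G⁻¹ • g := ⟨_, rfl⟩
  have e1 : f = F • f' := by rw [hf', smul_inv_smul₀ hF.ne']
  have e2 : g = G • g' := by rw [hg', smul_inv_smul₀ hG.ne']
  have bf : ∀ x, |f'.1 x| ≤ 1 := fun x => by
    have h := hf x
    rw [e1] at h
    change |F * f'.1 x| ≤ F at h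
    rw [abs_mul, abs_of_pos hF] at h
    exact le_of_mul_le_mul_left (by linarith) hF
  have bg : ∀ x, |g'.1 x| ≤ 1 := fun x => by
    have h := hg x
    rw [e2] at h
    change |G * g'.1 x| ≤ G at h
    rw [abs_mul, abs_of_pos hG] at h
    exact le_of_mul_le_mul_left (by linarith) hG
  have h1 : D.energyNorm ((f' + g') * (f' + g')) ≤ 2 * 2 * D.energyNorm (f' + g') :=
    energyNorm_mul_self_le _ (by norm_num) fun x =>
      (abs_add_le _ _).trans (by linarith [bf x, bg x])
  have h2 : D.energyNorm ((f' - g') * (f' - g')) ≤ 2 * 2 * D.energyNorm (f' - g') :=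
    energyNorm_mul_self_le _ (by norm_num) fun x =>
      (abs_sub _ _).trans (by linarith [bf x, bg x])
  have e3 : f' * g' = (1 / 4 : ℝ) • ((f' + g') * (f' + g') - (f' - g') * (f' - g')) := by
    ext x
    change f'.1 x * g'.1 x = 1 / 4 * ((f'.1 x + g'.1 x) * (f'.1 x + g'.1 x) -
      (f'.1 x - g'.1 x) * (f'.1 x - g'.1 x))
    ring
  have h3 : D.energyNorm (f' * g') ≤ 2 * (D.energyNorm f' + D.energyNorm g') := by
    rw [e3, energyNorm_smul]
    have := D.energyNorm_sub_le ((f' + g') * (f' + g')) ((f' - g') * (f' - g'))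
    have := D.energyNorm_add_le f' g'
    have := D.energyNorm_sub_le f' g'
    rw [abs_of_pos (by norm_num)]
    linarith
  have e4 : f * g = (F * G) • (f' * g') := by
    rw [e1, e2, smul_mul_smul_comm]
  rw [e4, energyNorm_smul, abs_of_pos (by positivity)]
  rw [e1, e2, energyNorm_smul, energyNorm_smul, abs_of_pos hF, abs_of_pos hG]
  nlinarith [mul_le_mul_of_nonneg_left h3 (mul_pos hF hG).le]

end Ring

/-! ### Positivity of the carré du champ -/

section Positivity

variable {K : Type*} [TopologicalSpace K] [CompactSpace K] [MeasurableSpace K] [BorelSpace K]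
  {μ : Measure K} [IsFiniteMeasure μ] {D : DirichletForm μ} [D.UnitalLocal]

/-- The carré du champ `(f, g, φ) ↦ ∫ φ dΓ(f, g)` on the core. -/
def coreCarre (D : DirichletForm μ) [D.UnitalLocal] : D.core →ₗ[ℝ] D.core →ₗ[ℝ] D.core →ₗ[ℝ] ℝ :=
  carre D.coreForm

lemma coreCarre_apply (f g φ : D.core) : D.coreCarre f g φ =
    (D.coreForm (φ * f) g + D.coreForm (φ * g) f - D.coreForm φ (f * g)) / 2 := rfl

lemma coreCarre_comm (f g φ : D.core) : D.coreCarre f g φ = D.coreCarre g f φ :=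
  carre_comm _ _ _ _

lemma coreCarre_one (f g : D.core) : D.coreCarre f g 1 = D.coreForm f g := by
  rw [coreCarre_apply, one_mul, one_mul, coreForm_one_left, D.coreForm_symm g f]
  ring

lemma coreCarre_mul_left (f g h φ : D.core) :
    D.coreCarre (f * g) h φ = D.coreCarre g h (φ * f) + D.coreCarre f h (φ * g) :=
  carre_mul_left D.coreForm_symm quartic_coreForm f g h φ

lemma coreCarre_one_left (h φ : D.core) : D.coreCarre 1 h φ = 0 := by
  have := coreCarre_mul_left 1 1 h φ
  simp only [mul_one] at this
  linarith

/-- With `u = c` wherever `v ≠ 0`: E(φu, v) = c E(φ, v), E(φv, u) = 0 and uv = cv, so the three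
terms cancel. -/
lemma coreCarre_cell_of_lt (f φ : D.core) {a b : ℝ} (hab : a ≤ b) {N i j : ℕ} (hij : i < j) :
    D.coreCarre (cell f a b N i) (cell f a b N j) φ = 0 := by
  have hc : ∀ x, (cell f a b N j).1 x ≠ 0 → (cell f a b N i).1 x = (b - a) / N :=
    fun x hx => cell_eq_of_ne_zero f hab hij hx
  generalize cell f a b N i = u at hc ⊢
  generalize cell f a b N j = v at hc ⊢
  generalize (b - a) / (N : ℝ) = c at hc ⊢
  have h1 : D.coreForm (φ * u - c • φ) v = 0 := coreForm_eq_zero_of_eq_const 0 fun x hx => by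
    change φ.1 x * u.1 x - c * φ.1 x = 0
    rw [hc x hx]; ring
  have h2 : D.coreForm u (φ * v) = 0 := coreForm_eq_zero_of_eq_const c fun x hx => by
    refine hc x fun h0 => hx ?_
    change φ.1 x * v.1 x = 0
    rw [h0, mul_zero]
  have h3 : u * v = c • v := by
    ext x
    change u.1 x * v.1 x = c * v.1 x
    by_cases hx : v.1 x = 0
    · rw [hx]; ring
    · rw [hc x hx]
  rw [map_sub, LinearMap.sub_apply, map_smul, LinearMap.smul_apply] at h1
  rw [coreCarre_apply, h3, D.coreForm_symm (φ * v), h2, map_smul]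
  linarith

lemma coreCarre_cell_of_ne (f φ : D.core) {a b : ℝ} (hab : a ≤ b) {N i j : ℕ} (hij : i ≠ j) :
    D.coreCarre (cell f a b N i) (cell f a b N j) φ = 0 := by
  rcases hij.lt_or_gt with h | h
  · exact coreCarre_cell_of_lt f φ hab h
  · rw [coreCarre_comm]; exact coreCarre_cell_of_lt f φ hab h

lemma sum_coreCarre_cell (f φ : D.core) {a b : ℝ} (hab : a ≤ b) {N : ℕ} (hN : 0 < N)
    (hf : ∀ x, f.1 x ∈ Set.Icc a b) :
    ∑ k ∈ Finset.range N, D.coreCarre (cell f a b N k) (cell f a b N k) φ =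
      D.coreCarre f f φ := by
  have hconst : ∀ g, D.coreCarre (D.const a) g φ = 0 := by
    intro g
    have : D.const a = a • (1 : D.core) := by
      ext x
      change a = a * 1
      ring
    rw [this, map_smul, LinearMap.smul_apply, LinearMap.smul_apply, coreCarre_one_left, smul_zero]
  have hs := sum_cell f hN hf
  have h1 : D.coreCarre (f - D.const a) (f - D.const a) φ = D.coreCarre f f φ := by
    simp only [map_sub, LinearMap.sub_apply, hconst]
    rw [coreCarre_comm f (D.const a), hconst]
    ring
  rw [← h1, ← hs, map_sum, LinearMap.sum_apply]
  refine Finset.sum_congr rfl fun i hi => ?_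
  rw [map_sum, LinearMap.sum_apply, LinearMap.sum_apply, Finset.sum_eq_single i]
  · exact fun j _ hj => coreCarre_cell_of_ne f φ hab hj
  · exact fun h => absurd hi h

/-- Squares of distinct slices are still orthogonal, and squaring a function with values in [0, (b -
a)/N] multiplies its energy norm by at most 2(b - a)/N. -/
lemma energyNorm_sum_cell_mul_self_le (f : D.core) {a b : ℝ} (hab : a ≤ b) {N : ℕ} (hN : 0 < N)
    (hf : ∀ x, f.1 x ∈ Set.Icc a b) :
    D.energyNorm (∑ k ∈ Finset.range N, cell f a b N k * cell f a b N k) ≤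
      2 * ((b - a) / N) * D.energyNorm f := by
  have hba := sub_nonneg.2 hab
  have h0 : 0 ≤ (b - a) / N := by positivity
  have horth : ∀ i j, i < j → D.coreForm (cell f a b N i * cell f a b N i)
      (cell f a b N j * cell f a b N j) = 0 := by
    intro i j hij
    refine coreForm_eq_zero_of_eq_const ((b - a) / N * ((b - a) / N)) fun x hx => ?_
    have hx' : (cell f a b N j).1 x ≠ 0 := fun h => hx (by
      change (cell f a b N j).1 x * (cell f a b N j).1 x = 0
      rw [h, mul_zero])
    change (cell f a b N i).1 x * (cell f a b N i).1 x = _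
    rw [cell_eq_of_ne_zero f hab hij hx']
  apply Real.sqrt_le_iff.2 ⟨mul_nonneg (by positivity) (D.energyNorm_nonneg f), ?_⟩
  have hsum : D.coreForm (∑ k ∈ Finset.range N, cell f a b N k * cell f a b N k)
      (∑ k ∈ Finset.range N, cell f a b N k * cell f a b N k) =
      ∑ k ∈ Finset.range N, D.energyNorm (cell f a b N k * cell f a b N k) ^ 2 := by
    rw [map_sum]
    refine Finset.sum_congr rfl fun i hi => ?_
    rw [map_sum, LinearMap.sum_apply, Finset.sum_eq_single i, energyNorm_sq]
    · intro j _ hj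
      rcases hj.lt_or_gt with h | h
      · exact horth _ _ h
      · rw [coreForm_symm]; exact horth _ _ h
    · exact fun h => absurd hi h
  rw [hsum, mul_pow, energyNorm_sq, ← sum_coreForm_cell f hab hN hf, Finset.mul_sum]
  refine Finset.sum_le_sum fun k _ => ?_
  rw [← energyNorm_sq, ← mul_pow]
  refine pow_le_pow_left₀ (D.energyNorm_nonneg _) ?_ 2
  refine energyNorm_mul_self_le _ h0 fun x => ?_
  rw [abs_of_nonneg (cell_nonneg f hab N k x)]
  exact cell_le f hab N k x

/-- Summing `carre_mul_self_mul_self` over the slices gives the lower bound -E(g, gv), where `v` is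
the sum of the squared slices. Both the sup norm and the energy norm of `v` are O(1/N), hence so is
this error. -/
lemma coreCarre_mul_self_nonneg (f g : D.core) : 0 ≤ D.coreCarre f f (g * g) := by
  obtain ⟨M, hM, hfM⟩ := exists_bound f.1 f.2.1
  obtain ⟨G, hG, hgG⟩ := exists_bound g.1 g.2.1
  have hab : -M ≤ M := by linarith
  have hf : ∀ x, f.1 x ∈ Set.Icc (-M) M := fun x => abs_le.1 (hfM x)
  set C : ℝ := D.energyNorm g * (2 * (G * (2 * (M - -M) * D.energyNorm f) +
    (M - -M) * (M - -M) * D.energyNorm g)) with hC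
  have key : ∀ n : ℕ, -(C / ((n + 1 : ℕ) : ℝ)) ≤ D.coreCarre f f (g * g) := by
    intro n
    have hN : 0 < n + 1 := n.succ_pos
    have hNr : (0 : ℝ) < ((n + 1 : ℕ) : ℝ) := by positivity
    set v : D.core := ∑ k ∈ Finset.range (n + 1), cell f (-M) M (n + 1) k * cell f (-M) M (n + 1) k
      with hv
    have hvb : ∀ x, |v.1 x| ≤ (M - -M) / (n + 1 : ℕ) * (M - -M) := by
      intro x
      have e : v.1 x = ∑ k ∈ Finset.range (n + 1),
          (cell f (-M) M (n + 1) k).1 x * (cell f (-M) M (n + 1) k).1 x := by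
        rw [hv, coe_sum_core]; rfl
      have e2 : ∑ k ∈ Finset.range (n + 1), (cell f (-M) M (n + 1) k).1 x = f.1 x - -M := by
        rw [← coe_sum_core, sum_cell f hN hf]; rfl
      rw [e, abs_of_nonneg (Finset.sum_nonneg fun k _ => mul_self_nonneg _)]
      calc _ ≤ ∑ k ∈ Finset.range (n + 1),
            (M - -M) / (n + 1 : ℕ) * (cell f (-M) M (n + 1) k).1 x :=
            Finset.sum_le_sum fun k _ => mul_le_mul_of_nonneg_right (cell_le f hab _ _ x)
              (cell_nonneg f hab _ _ x)
        _ = (M - -M) / (n + 1 : ℕ) * (f.1 x - -M) := by rw [← Finset.mul_sum, e2]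
        _ ≤ _ := by
          have := (hf x).2
          have : 0 ≤ M - -M := by linarith
          gcongr
    have hve := energyNorm_sum_cell_mul_self_le f hab hN hf
    rw [← hv] at hve
    have hgv := energyNorm_mul_le g v hG (G := (M - -M) / (n + 1 : ℕ) * (M - -M))
      (by have : 0 < M - -M := by linarith
          positivity) hgG hvb
    have h1 : D.coreCarre f f (g * g) ≥ -D.coreForm g (g * v) := by
      rw [← sum_coreCarre_cell f (g * g) hab hN hf, hv, Finset.mul_sum, map_sum,
        ← Finset.sum_neg_distrib]
      refine Finset.sum_le_sum fun k _ => ?_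
      have := carre_mul_self_mul_self D.coreForm_symm quartic_coreForm g (cell f (-M) M (n + 1) k)
      change _ ≤ carre D.coreForm _ _ _
      rw [this]
      have := D.coreForm_nonneg (g * cell f (-M) M (n + 1) k)
      linarith
    have h2 := le_of_abs_le (D.abs_coreForm_le g (g * v))
    have h3 : D.energyNorm g * D.energyNorm (g * v) ≤ C / ((n + 1 : ℕ) : ℝ) := by
      calc _ ≤ D.energyNorm g * (2 * (G * (2 * ((M - -M) / (n + 1 : ℕ)) * D.energyNorm f) +
            (M - -M) / (n + 1 : ℕ) * (M - -M) * D.energyNorm g)) := by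
            refine mul_le_mul_of_nonneg_left ?_ (D.energyNorm_nonneg g)
            have := mul_le_mul_of_nonneg_left hve hG.le
            linarith
        _ = C / ((n + 1 : ℕ) : ℝ) := by rw [hC]; ring
    linarith
  have hlim : Tendsto (fun n : ℕ => -(C / ((n + 1 : ℕ) : ℝ))) atTop (𝓝 (-0)) :=
    ((tendsto_const_div_atTop_nhds_zero_nat C).comp (tendsto_add_atTop_nat 1)).neg
  rw [neg_zero] at hlim
  exact le_of_tendsto' hlim key

/-- Positivity of the carré du champ. -/
lemma coreCarre_nonneg (f φ : D.core) (hφ : ∀ x, 0 ≤ φ.1 x) : 0 ≤ D.coreCarre f f φ := by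
  obtain ⟨M, hM, hφM⟩ := exists_bound φ.1 φ.2.1
  have key : ∀ δ > 0, 0 ≤ D.coreCarre f f φ + δ * D.coreForm f f := by
    intro δ hδ
    -- The shift by δ keeps the square root C¹ on the range of φ, which may contain 0; its cost is δ
    -- E(f, f).
    have hmem : (fun s => √(s + δ)) ∘ φ.1 ∈ D.core := by
      refine comp_mem_core (ψ' := fun s => 1 / (2 * √(s + δ))) hM.le (fun t ht => ?_) ?_ φ
        fun x => ⟨hφ x, le_of_abs_le (hφM x)⟩
      · have : t + δ ≠ 0 := by have := ht.1; positivity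
        simpa using ((hasDerivAt_id t).add_const δ).sqrt this
      · refine ContinuousOn.div continuousOn_const (by fun_prop) fun t ht => ?_
        have := ht.1
        positivity
    have h := coreCarre_mul_self_nonneg f ⟨_, hmem⟩
    have e : (⟨_, hmem⟩ : D.core) * ⟨_, hmem⟩ = φ + δ • (1 : D.core) := by
      ext x
      change √(φ.1 x + δ) * √(φ.1 x + δ) = φ.1 x + δ * 1
      have := hφ x
      rw [Real.mul_self_sqrt (by positivity), mul_one]
    rw [e, map_add, map_smul, coreCarre_one, smul_eq_mul] at h
    exact h
  by_contra! hneg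
  have h0 := D.coreForm_nonneg f
  -- This δ makes the cost at most half of the supposed negative value; the added 1 covers zero
  -- energy.
  have h := key (-D.coreCarre f f φ / (2 * (D.coreForm f f + 1)))
    (by have : 0 < -D.coreCarre f f φ := by linarith
        positivity)
  have h1 : -D.coreCarre f f φ / (2 * (D.coreForm f f + 1)) * D.coreForm f f ≤
      -D.coreCarre f f φ / 2 := by
    rw [div_mul_eq_mul_div, div_le_div_iff₀ (by positivity) (by positivity)]
    nlinarith
  linarith

end Positivity

end DirichletForm

/-! ### Energy measures and the functionals Γ(a, c) on C(K) -/

/-- Integration against a finite measure, as a functional on continuous functions. -/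
def integralCLM {K : Type*} [TopologicalSpace K] [CompactSpace K] [MeasurableSpace K]
    [BorelSpace K] (ν : Measure K) [IsFiniteMeasure ν] : C(K, ℝ) →L[ℝ] ℝ :=
  LinearMap.mkContinuous
    { toFun := fun φ => ∫ x, φ x ∂ν
      map_add' := fun φ ψ => integral_add
        (φ.continuous.integrable_of_hasCompactSupport (HasCompactSupport.of_compactSpace _))
        (ψ.continuous.integrable_of_hasCompactSupport (HasCompactSupport.of_compactSpace _))
      map_smul' := fun c φ => integral_const_mul c _ } (ν.real Set.univ) fun φ => by
    rw [mul_comm]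
    exact norm_integral_le_of_norm_le_const (Eventually.of_forall φ.norm_coe_le_norm)

/-- Uniform approximation of finitely many functions by means of a partition of unity. -/
lemma exists_partition_approx {K : Type*} [TopologicalSpace K] [CompactSpace K] [T2Space K]
    {ι : Type*} [Finite ι] (g : ι → C(K, ℝ)) {ε : ℝ} (hε : 0 < ε) :
    ∃ (t : Finset K) (χ : t → C(K, ℝ)), (∀ k x, 0 ≤ χ k x) ∧
      ∀ i, ‖g i - ∑ k : t, g i k • χ k‖ ≤ ε := by
  let U : K → Set K := fun x => {y | ∀ i, |g i y - g i x| < ε}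
  have hU : ∀ x, IsOpen (U x) := fun x => by
    have : U x = ⋂ i, {y | |g i y - g i x| < ε} := by ext; simp [U]
    rw [this]
    exact isOpen_iInter_of_finite fun i => isOpen_lt (by fun_prop) continuous_const
  obtain ⟨t, ht⟩ := isCompact_univ.elim_finite_subcover U hU
    (fun x _ => Set.mem_iUnion.2 ⟨x, fun i => by simpa using hε⟩)
  obtain ⟨χ, hχ⟩ := PartitionOfUnity.exists_isSubordinate isClosed_univ (fun k : t => U k)
    (fun k => hU k) (by
      intro x hx
      obtain ⟨k, hk, hxk⟩ := Set.mem_iUnion₂.1 (ht hx)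
      exact Set.mem_iUnion.2 ⟨⟨k, hk⟩, hxk⟩)
  refine ⟨t, fun k => χ k, fun k x => χ.nonneg k x, fun i => ?_⟩
  rw [ContinuousMap.norm_le _ hε.le]
  intro x
  have h1 : ∑ k, χ k x = 1 := by
    rw [← finsum_eq_sum_of_fintype]
    exact χ.sum_eq_one trivial
  have h2 : (g i - ∑ k : t, g i k • (χ k : C(K, ℝ))) x = ∑ k : t, (g i x - g i k) * χ k x := by
    simp only [sub_mul, Finset.sum_sub_distrib, ← Finset.mul_sum, h1]
    simp [ContinuousMap.sum_apply]
  rw [h2, Real.norm_eq_abs]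
  calc _ ≤ ∑ k : t, |(g i x - g i k) * χ k x| := Finset.abs_sum_le_sum_abs _ _
    _ ≤ ∑ k, ε * χ k x := by
      refine Finset.sum_le_sum fun k _ => ?_
      rw [abs_mul, abs_of_nonneg (χ.nonneg k x)]
      by_cases h0 : χ k x = 0
      · rw [h0]; simp
      · exact mul_le_mul_of_nonneg_right (hχ k (subset_closure h0) i).le (χ.nonneg k x)
    _ = ε := by rw [← Finset.mul_sum, h1, mul_one]

namespace DirichletForm

section EnergyMeasure

variable {K : Type*} [TopologicalSpace K] [CompactSpace K] [T2Space K] [MeasurableSpace K]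
  [BorelSpace K] {μ : Measure K} [IsFiniteMeasure μ] {D : DirichletForm μ} [D.UnitalLocal]

/-- Elements of the core as bundled continuous functions. -/
def toC : D.core →ₗ[ℝ] C(K, ℝ) where
  toFun f := ⟨f.1, f.2.1⟩
  map_add' _ _ := rfl
  map_smul' _ _ := rfl

@[simp] lemma toC_apply (f : D.core) (x : K) : toC f x = f.1 x := rfl

lemma toC_mul (f g : D.core) : toC (f * g) = toC f * toC g := rfl

lemma exists_core_norm_sub_le (φ : C(K, ℝ)) {ε : ℝ} (hε : 0 < ε) :
    ∃ f : D.core, ‖toC f - φ‖ ≤ ε := by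
  obtain ⟨g, hg, h⟩ := (UnitalLocal.isRegular (D := D)).1 φ φ.continuous
    (HasCompactSupport.of_compactSpace _) ε hε
  refine ⟨⟨g, hg⟩, (ContinuousMap.norm_le _ hε.le).2 fun x => ?_⟩
  have := (h x).le
  rwa [abs_sub_comm] at this

lemma denseRange_toC : DenseRange (toC : D.core → C(K, ℝ)) := by
  rw [Metric.denseRange_iff]
  intro φ ε hε
  obtain ⟨f, hf⟩ := exists_core_norm_sub_le (D := D) φ (half_pos hε)
  refine ⟨f, ?_⟩
  rw [dist_comm, dist_eq_norm]
  linarith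

/-- The coercion of continuous functions to functions, as a linear map. -/
def coeLinear (K : Type*) [TopologicalSpace K] : C(K, ℝ) →ₗ[ℝ] K → ℝ where
  toFun φ := φ
  map_add' _ _ := rfl
  map_smul' _ _ := rfl

/-- The functional `φ ↦ coreCarre f f φ` as a partially defined functional on `C(K, ℝ)`. -/
def carrePMap (f : D.core) : C(K, ℝ) →ₗ.[ℝ] ℝ where
  domain := D.core.comap (coeLinear K)
  toFun := (D.coreCarre f f).comp ((coeLinear K).submoduleComap D.core)

lemma carrePMap_apply (f : D.core) (φ : (carrePMap f).domain) :
    carrePMap f φ = D.coreCarre f f ⟨φ.1, φ.2⟩ := rfl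

/-- The cone of nonnegative continuous functions. -/
def nonnegCone (K : Type*) [TopologicalSpace K] : PointedCone ℝ C(K, ℝ) where
  carrier := {φ | ∀ x, 0 ≤ φ x}
  add_mem' := fun hφ hψ x => add_nonneg (hφ x) (hψ x)
  zero_mem' := fun _ => le_rfl
  smul_mem' := fun c _ hφ x => mul_nonneg c.2 (hφ x)

/-- Since the core contains the constants, it is cofinal in C(K), so the positive functional extends
from the core to all of C(K); Riesz-Markov represents the extension by a measure. -/
lemma exists_isEnergyMeasure (f : D.core) : ∃ ν, D.IsEnergyMeasure f ν := by
  obtain ⟨Λ, hΛ, hpos⟩ := riesz_extension (nonnegCone K) (carrePMap f)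
    (fun φ hφ => by rw [carrePMap_apply]; exact coreCarre_nonneg f _ hφ)
    (fun φ => ⟨⟨ContinuousMap.const K ‖φ‖, D.const_mem ‖φ‖⟩, fun x => by
      change 0 ≤ ‖φ‖ + φ x
      linarith [neg_le_of_abs_le (φ.norm_coe_le_norm x)]⟩)
  let Λ' : CompactlySupportedContinuousMap K ℝ →ₚ[ℝ] ℝ := PositiveLinearMap.mk₀
    { toFun := fun φ => Λ φ.toContinuousMap
      map_add' := fun φ ψ => map_add Λ φ.toContinuousMap ψ.toContinuousMap
      map_smul' := fun c φ => map_smul Λ c φ.toContinuousMap }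
    (fun φ hφ => hpos _ hφ)
  refine ⟨RealRMK.rieszMeasure Λ', inferInstance, inferInstance, fun φ => ?_⟩
  have h1 := RealRMK.integral_rieszMeasure Λ'
    ⟨(toC φ : C(K, ℝ)), HasCompactSupport.of_compactSpace _⟩
  have h2 := hΛ ⟨toC φ, φ.2⟩
  change ∫ x, φ.1 x ∂(RealRMK.rieszMeasure Λ') = Λ (toC φ) at h1
  change Λ (toC φ) = D.coreCarre f f φ at h2
  rw [h1, h2, coreCarre_apply, ← coe_mul_core, ← coe_mul_core, energy_core, energy_core]
  ring

lemma isEnergyMeasure_energyMeasure (f : D.core) : D.IsEnergyMeasure f (D.energyMeasure f) := by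
  unfold energyMeasure
  rw [dif_pos (exists_isEnergyMeasure f)]
  exact (exists_isEnergyMeasure f).choose_spec

lemma integral_energyMeasure (f φ : D.core) :
    ∫ x, φ.1 x ∂(D.energyMeasure f) = D.coreCarre f f φ := by
  rw [(isEnergyMeasure_energyMeasure f).2.2 φ, coreCarre_apply, ← coe_mul_core, ← coe_mul_core,
    energy_core, energy_core]
  ring

lemma mutualEnergyIntegral_core (a c φ : D.core) :
    D.mutualEnergyIntegral a c φ.1 = D.coreCarre a c φ := by
  unfold mutualEnergyIntegral
  rw [integral_energyMeasure, integral_energyMeasure]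
  simp only [map_add, map_sub, LinearMap.add_apply, LinearMap.sub_apply]
  rw [coreCarre_comm c a]
  ring

lemma measureReal_energyMeasure_univ (f : D.core) :
    (D.energyMeasure f).real Set.univ = D.coreForm f f := by
  rw [← coreCarre_one, ← integral_energyMeasure]
  simp

/-- The mutual energy integral as a functional on continuous functions. -/
def gammaCLM (a c : D.core) : C(K, ℝ) →L[ℝ] ℝ :=
  (1 / 4 : ℝ) • (integralCLM (D.energyMeasure (a + c)) - integralCLM (D.energyMeasure (a - c)))

lemma gammaCLM_toC (a c φ : D.core) : gammaCLM a c (toC φ) = D.coreCarre a c φ :=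
  mutualEnergyIntegral_core a c φ

lemma clm_ext {L L' : C(K, ℝ) →L[ℝ] ℝ} (h : ∀ φ : D.core, L (toC φ) = L' (toC φ)) : L = L' :=
  DFunLike.coe_injective
    (denseRange_toC.equalizer (f := (toC : D.core → C(K, ℝ))) L.continuous L'.continuous (funext h))

/-- The functional `φ ↦ ∫ φ dΓ(a, c)`, bilinear in `a` and `c`. -/
def gamma (D : DirichletForm μ) [D.UnitalLocal] :
    D.core →ₗ[ℝ] D.core →ₗ[ℝ] C(K, ℝ) →L[ℝ] ℝ :=
  LinearMap.mk₂ ℝ gammaCLM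
    (fun a a' c => clm_ext (D := D) fun φ => by
      simp only [add_apply, gammaCLM_toC, map_add, LinearMap.add_apply])
    (fun r a c => clm_ext (D := D) fun φ => by
      simp only [smul_apply, gammaCLM_toC, map_smul, LinearMap.smul_apply])
    (fun a c c' => clm_ext (D := D) fun φ => by
      simp only [add_apply, gammaCLM_toC, map_add, LinearMap.add_apply])
    (fun r a c => clm_ext (D := D) fun φ => by
      simp only [smul_apply, gammaCLM_toC, map_smul, LinearMap.smul_apply])

lemma gamma_eq (a c : D.core) (φ : C(K, ℝ)) :
    D.gamma a c φ = D.mutualEnergyIntegral a c φ := rfl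

lemma gamma_toC (a c φ : D.core) : D.gamma a c (toC φ) = D.coreCarre a c φ := gammaCLM_toC a c φ

lemma gamma_comm (a c : D.core) : D.gamma a c = D.gamma c a :=
  clm_ext (D := D) fun φ => by rw [gamma_toC, gamma_toC, coreCarre_comm]

lemma gamma_one (a c : D.core) : D.gamma a c 1 = D.coreForm a c := by
  have : (1 : C(K, ℝ)) = toC (1 : D.core) := rfl
  rw [this, gamma_toC, coreCarre_one]

lemma gamma_self (f : D.core) : D.gamma f f = integralCLM (D.energyMeasure f) :=
  clm_ext (D := D) fun φ => by
    rw [gamma_toC]; exact (integral_energyMeasure f φ).symm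

lemma gamma_self_nonneg (f : D.core) (φ : C(K, ℝ)) (hφ : ∀ x, 0 ≤ φ x) : 0 ≤ D.gamma f f φ := by
  rw [gamma_self]
  exact integral_nonneg hφ

lemma abs_gamma_self_le (f : D.core) (φ : C(K, ℝ)) :
    |D.gamma f f φ| ≤ ‖φ‖ * D.coreForm f f := by
  rw [gamma_self, ← measureReal_energyMeasure_univ]
  exact norm_integral_le_of_norm_le_const (Eventually.of_forall φ.norm_coe_le_norm)

lemma abs_gamma_le (a c : D.core) (φ : C(K, ℝ)) :
    |D.gamma a c φ| ≤ ‖φ‖ * (D.coreForm a a + D.coreForm c c) / 2 := by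
  have h1 := abs_le.1 (abs_gamma_self_le (a + c) φ)
  have h2 := abs_le.1 (abs_gamma_self_le (a - c) φ)
  simp only [map_add, map_sub, LinearMap.add_apply, LinearMap.sub_apply,
    add_apply, sub_apply] at h1 h2
  rw [gamma_comm c a, D.coreForm_symm c a] at h1 h2
  rw [abs_le]
  constructor <;> nlinarith

/-- With coefficients frozen at the points of a partition of unity, the double sum becomes a sum of
terms Γ(s, s)(χ) with χ ≥ 0, where s is a linear combination of the `a i`. The error is at most ε
times a constant depending only on the energies. -/
lemma sum_gamma_mul_nonneg {ι : Type*} [Fintype ι] (a : ι → D.core) (b : ι → C(K, ℝ)) :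
    0 ≤ ∑ i, ∑ j, D.gamma (a i) (a j) (b i * b j) := by
  set C : ℝ := ∑ i, ∑ j, (D.coreForm (a i) (a i) + D.coreForm (a j) (a j)) / 2 with hC
  have hC0 : 0 ≤ C := Finset.sum_nonneg fun i _ => Finset.sum_nonneg fun j _ => by
    have := D.coreForm_nonneg (a i)
    have := D.coreForm_nonneg (a j)
    positivity
  have key : ∀ ε > 0, -(ε * C) ≤ ∑ i, ∑ j, D.gamma (a i) (a j) (b i * b j) := by
    intro ε hε
    obtain ⟨t, χ, hχ0, hχ⟩ := exists_partition_approx (fun p : ι × ι => b p.1 * b p.2) hε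
    have h1 : 0 ≤ ∑ i, ∑ j, D.gamma (a i) (a j) (∑ k, (b i * b j) k.1 • χ k) := by
      have : ∑ i, ∑ j, D.gamma (a i) (a j) (∑ k, (b i * b j) k.1 • χ k) =
          ∑ k, D.gamma (∑ i, b i k.1 • a i) (∑ i, b i k.1 • a i) (χ k) := by
        simp only [map_sum, map_smul, LinearMap.sum_apply, LinearMap.smul_apply,
          sum_apply, smul_apply, smul_eq_mul,
          ContinuousMap.mul_apply]
        rw [Finset.sum_congr rfl fun i _ => Finset.sum_comm, Finset.sum_comm]
        refine Finset.sum_congr rfl fun k _ => ?_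
        rw [Finset.sum_comm]
        simp only [Finset.mul_sum, mul_assoc]
        refine Finset.sum_congr rfl fun i _ => Finset.sum_congr rfl fun j _ => ?_
        ring
      rw [this]
      exact Finset.sum_nonneg fun k _ => gamma_self_nonneg _ _ (hχ0 k)
    have h2 : ∑ i, ∑ j, D.gamma (a i) (a j) (b i * b j - ∑ k, (b i * b j) k.1 • χ k) ≥ -(ε * C) := by
      rw [hC, Finset.mul_sum, ← Finset.sum_neg_distrib]
      refine Finset.sum_le_sum fun i _ => ?_
      rw [Finset.mul_sum, ← Finset.sum_neg_distrib]
      refine Finset.sum_le_sum fun j _ => ?_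
      have h3 := (abs_le.1 (abs_gamma_le (a i) (a j)
        (b i * b j - ∑ k, (b i * b j) k.1 • χ k))).1
      have h4 := hχ (i, j)
      have h5 := D.coreForm_nonneg (a i)
      have h6 := D.coreForm_nonneg (a j)
      refine le_trans (neg_le_neg ?_) h3
      rw [mul_div_assoc]
      gcongr
    simp only [map_sub, Finset.sum_sub_distrib] at h2
    linarith
  have hlim : Tendsto (fun ε : ℝ => -(ε * C)) (𝓝[>] 0) (𝓝 (-(0 * C))) := by
    have : Continuous fun ε : ℝ => -(ε * C) := by fun_prop
    exact (this.tendsto 0).mono_left nhdsWithin_le_nhds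
  rw [zero_mul, neg_zero] at hlim
  exact le_of_tendsto hlim (eventually_mem_nhdsWithin.mono fun ε hε => key ε hε)

end EnergyMeasure

end DirichletForm

namespace DirichletForm

/-! ### The inner product on C ⊗ C and the elements a ⊗ g -/

section TensorForm

variable {K : Type*} [TopologicalSpace K] [CompactSpace K] [T2Space K] [MeasurableSpace K]
  [BorelSpace K] {μ : Measure K} [IsFiniteMeasure μ] {D : DirichletForm μ} [D.UnitalLocal]

/-- The bilinear form on the tensor square of the core induced by the carré du champ. -/
def carreTensor (D : DirichletForm μ) [D.UnitalLocal] :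
    D.core ⊗[ℝ] D.core →ₗ[ℝ] D.core ⊗[ℝ] D.core →ₗ[ℝ] ℝ :=
  TensorProduct.curry
    ((TensorProduct.lift ((TensorProduct.lift D.coreCarre).compl₂ (LinearMap.mul' ℝ D.core))).comp
      (TensorProduct.tensorTensorTensorComm ℝ D.core D.core D.core D.core).toLinearMap)

lemma carreTensor_tmul (a b c d : D.core) :
    D.carreTensor (a ⊗ₜ b) (c ⊗ₜ d) = D.coreCarre a c (b * d) := by
  simp [carreTensor]

lemma carreTensor_comm (s t : D.core ⊗[ℝ] D.core) : D.carreTensor s t = D.carreTensor t s := by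
  induction s using TensorProduct.induction_on with
  | zero => simp
  | add s s' hs hs' => simp only [map_add, LinearMap.add_apply, hs, hs']
  | tmul a b =>
    induction t using TensorProduct.induction_on with
    | zero => simp
    | add s s' hs hs' => simp only [map_add, LinearMap.add_apply, hs, hs']
    | tmul c d => rw [carreTensor_tmul, carreTensor_tmul, coreCarre_comm, mul_comm b d]

lemma carreTensor_self_nonneg (s : D.core ⊗[ℝ] D.core) : 0 ≤ D.carreTensor s s := by
  obtain ⟨n, a, b, rfl⟩ := TensorProduct.exists_sum_tmul_eq s
  have h := sum_gamma_mul_nonneg a fun i => toC (b i)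
  simp only [map_sum, LinearMap.sum_apply, carreTensor_tmul]
  rw [Finset.sum_comm]
  simpa only [← toC_mul, gamma_toC] using h

lemma exists_isTensorForm (D : DirichletForm μ) [D.UnitalLocal] :
    ∃ B : LinearMap.BilinForm ℝ D.PreH, D.IsTensorForm B := by
  refine ⟨(D.carreTensor : LinearMap.BilinForm ℝ D.PreH),
    ⟨⟨fun s t => carreTensor_comm s t⟩, ⟨fun s => carreTensor_self_nonneg s⟩⟩, ?_⟩
  intro a b c d
  rw [← coe_mul_core, mutualEnergyIntegral_core]
  exact carreTensor_tmul a b c d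

lemma isTensorForm_tensorForm (D : DirichletForm μ) [D.UnitalLocal] :
    D.IsTensorForm D.tensorForm := by
  unfold tensorForm
  rw [dif_pos D.exists_isTensorForm]
  exact D.exists_isTensorForm.choose_spec

lemma inner_simpleTensor (a b c d : D.core) :
    inner ℝ (D.simpleTensor a b : D.H) (D.simpleTensor c d : D.H) =
      D.gamma a c (toC b * toC d) := by
  rw [UniformSpace.Completion.inner_coe, ← toC_mul, gamma_toC, ← mutualEnergyIntegral_core]
  exact D.isTensorForm_tensorForm.2 a b c d

lemma simpleTensor_sub (a b b' : D.core) :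
    D.simpleTensor a (b - b') = D.simpleTensor a b - D.simpleTensor a b' :=
  TensorProduct.tmul_sub a b b'

lemma norm_simpleTensor_le (a b : D.core) :
    ‖(D.simpleTensor a b : D.H)‖ ≤ ‖(toC b : C(K, ℝ))‖ * D.energyNorm a := by
  refine (pow_le_pow_iff_left₀ (norm_nonneg _)
    (mul_nonneg (norm_nonneg _) (D.energyNorm_nonneg a)) two_ne_zero).1 ?_
  rw [← real_inner_self_eq_norm_sq, inner_simpleTensor, mul_pow, energyNorm_sq]
  refine (le_abs_self _).trans ((abs_gamma_self_le _ _).trans ?_)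
  refine mul_le_mul_of_nonneg_right ?_ (D.coreForm_nonneg a)
  rw [sq]
  exact norm_mul_le _ _

/-- Identifies the filter with sup-norm neighbourhoods, so that density of the core in C(K) makes it
nontrivial. -/
lemma uniformNhds_eq_comap (g : C(K, ℝ)) :
    D.uniformNhds g = comap (toC : D.core → C(K, ℝ)) (𝓝 g) := by
  have h1 := (Metric.nhds_basis_closedBall (x := g)).comap (toC : D.core → C(K, ℝ))
  rw [h1.eq_biInf, uniformNhds, iInf_subtype]
  refine iInf_congr fun ε => iInf_congr fun hε => ?_
  congr 1
  ext b
  change (∀ x, |b.1 x - g x| ≤ ε) ↔ dist (toC b) g ≤ ε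
  rw [dist_eq_norm, ContinuousMap.norm_le _ (le_of_lt hε)]
  rfl

lemma uniformNhds_neBot (g : C(K, ℝ)) : (D.uniformNhds g).NeBot := by
  rw [uniformNhds_eq_comap]
  exact comap_neBot fun t ht => denseRange_toC.mem_nhds ht

lemma tendsto_toC_uniformNhds (g : C(K, ℝ)) :
    Tendsto (toC : D.core → C(K, ℝ)) (D.uniformNhds g) (𝓝 g) := by
  rw [uniformNhds_eq_comap]
  exact tendsto_comap

/-- For fixed `a`, the map b ↦ a ⊗ b is Lipschitz from the sup norm to the Hilbert space, so it
sends the filter to a Cauchy filter. -/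
lemma tendsto_tensor (a : D.core) (g : C(K, ℝ)) :
    Tendsto (fun b : D.core => (D.simpleTensor a b : D.H)) (D.uniformNhds g)
      (𝓝 (D.tensor a g)) := by
  have := uniformNhds_neBot (D := D) g
  refine tendsto_nhds_limUnder (cauchy_map_iff_exists_tendsto.1 ?_)
  have he := D.energyNorm_nonneg a
  refine Metric.cauchy_iff.2 ⟨inferInstance, fun ε hε => ?_⟩
  set δ : ℝ := ε / (4 * (D.energyNorm a + 1)) with hδ
  have hδ0 : 0 < δ := by positivity
  have hmem := tendsto_toC_uniformNhds (D := D) g (Metric.ball_mem_nhds g hδ0)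
  refine ⟨_, image_mem_map hmem, ?_⟩
  rintro _ ⟨b, hb, rfl⟩ _ ⟨b', hb', rfl⟩
  have hd : ‖(toC (b - b') : C(K, ℝ))‖ ≤ 2 * δ := by
    rw [map_sub, ← dist_eq_norm]
    have := dist_triangle_right (toC b) (toC b') g
    have h1 : dist (toC b) g < δ := hb
    have h2 : dist (toC b') g < δ := hb'
    linarith
  rw [dist_eq_norm, ← UniformSpace.Completion.coe_sub, ← simpleTensor_sub]
  refine (norm_simpleTensor_le a (b - b')).trans_lt ?_
  calc _ ≤ 2 * δ * D.energyNorm a := by gcongr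
    _ = ε / 2 * (D.energyNorm a / (D.energyNorm a + 1)) := by rw [hδ]; field_simp; ring
    _ ≤ ε / 2 * 1 := by
      gcongr
      rw [div_le_one (by positivity)]
      linarith
    _ < ε := by linarith

lemma inner_tensor (a c : D.core) (g g' : C(K, ℝ)) :
    inner ℝ (D.tensor a g) (D.tensor c g') = D.gamma a c (g * g') := by
  have := uniformNhds_neBot (D := D) g
  have := uniformNhds_neBot (D := D) g'
  have h1 := ((tendsto_tensor a g).comp tendsto_fst).inner (𝕜 := ℝ)
    ((tendsto_tensor c g').comp (tendsto_snd (f := D.uniformNhds g)))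
  have h2 : Tendsto (fun p : D.core × D.core => D.gamma a c (toC p.1 * toC p.2))
      (D.uniformNhds g ×ˢ D.uniformNhds g') (𝓝 (D.gamma a c (g * g'))) :=
    ((D.gamma a c).continuous.tendsto _).comp
      (((tendsto_toC_uniformNhds g).comp tendsto_fst).mul
        ((tendsto_toC_uniformNhds g').comp tendsto_snd))
  refine tendsto_nhds_unique h1 (h2.congr fun p => ?_)
  exact (inner_simpleTensor _ _ _ _).symm

lemma norm_sum_tensor_sq {ι : Type*} [Fintype ι] (a : ι → D.core) (g : ι → C(K, ℝ)) :
    ‖∑ i, D.tensor (a i) (g i)‖ ^ 2 = ∑ i, ∑ j, D.gamma (a i) (a j) (g i * g j) := by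
  rw [← real_inner_self_eq_norm_sq, sum_inner]
  simp only [inner_sum, inner_tensor]

end TensorForm

end DirichletForm

/-! ### The space of jets and the chain rule for C¹ functions of one variable -/

lemma Polynomial.exists_derivative_eq (p : Polynomial ℝ) :
    ∃ P : Polynomial ℝ, Polynomial.derivative P = p := by
  induction p using Polynomial.induction_on' with
  | add p q hp hq =>
    obtain ⟨P, rfl⟩ := hp
    obtain ⟨Q, rfl⟩ := hq
    exact ⟨P + Q, map_add _ _ _⟩
  | monomial n a =>
    refine ⟨Polynomial.monomial (n + 1) (a / (n + 1)), ?_⟩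
    rw [Polynomial.derivative_monomial, Nat.add_sub_cancel]
    congr 1
    push_cast
    field_simp

namespace DirichletForm

section Chain

variable {K : Type*} [TopologicalSpace K] [CompactSpace K] [T2Space K] [MeasurableSpace K]
  [BorelSpace K] {μ : Measure K} [IsFiniteMeasure μ] {D : DirichletForm μ} [D.UnitalLocal]

/-- Replacing `a` by `t • a` in `abs_gamma_le` gives a quadratic in `t` that is nowhere negative;
its discriminant is the claim. -/
lemma abs_gamma_le_mul (a c : D.core) (φ : C(K, ℝ)) :
    |D.gamma a c φ| ≤ ‖φ‖ * (D.energyNorm a * D.energyNorm c) := by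
  have hq : ∀ t : ℝ, 0 ≤ ‖φ‖ * D.coreForm a a * (t * t) + 2 * D.gamma a c φ * t +
      ‖φ‖ * D.coreForm c c := by
    intro t
    have h := (abs_le.1 (abs_gamma_le (t • a) c φ)).1
    simp only [map_smul, LinearMap.smul_apply, smul_apply, smul_eq_mul] at h
    nlinarith
  have hd := discrim_le_zero hq
  rw [discrim, ← energyNorm_sq, ← energyNorm_sq] at hd
  refine abs_le_of_sq_le_sq ?_ (mul_nonneg (norm_nonneg _)
    (mul_nonneg (D.energyNorm_nonneg a) (D.energyNorm_nonneg c)))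
  nlinarith

lemma gamma_mul_left (f g h : D.core) (φ : C(K, ℝ)) :
    D.gamma (f * g) h φ = D.gamma g h (φ * toC f) + D.gamma f h (φ * toC g) := by
  have h1 : D.gamma (f * g) h =
      (D.gamma g h).comp ((ContinuousLinearMap.mul ℝ C(K, ℝ)).flip (toC f)) +
        (D.gamma f h).comp ((ContinuousLinearMap.mul ℝ C(K, ℝ)).flip (toC g)) :=
    clm_ext (D := D) fun φ => by
      simp only [add_apply, ContinuousLinearMap.comp_apply, ContinuousLinearMap.flip_apply,
        ContinuousLinearMap.mul_apply', ← toC_mul, gamma_toC]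
      exact coreCarre_mul_left f g h φ
  rw [h1]
  rfl

lemma gamma_one_left (h : D.core) (φ : C(K, ℝ)) : D.gamma 1 h φ = 0 := by
  have h1 := gamma_mul_left 1 1 h φ
  have h2 : (toC (1 : D.core) : C(K, ℝ)) = 1 := rfl
  simp only [h2, mul_one] at h1
  linarith

/-- The pairs `(u, v)` of a function `u` in the core and a family `v` of continuous functions such
that `Γ(u, h) = ∑ᵢ vᵢ Γ(cᵢ, h)` for all `h` in the core. -/
def jetSpace {ι : Type*} [Fintype ι] (c : ι → D.core) :
    Submodule ℝ (C(K, ℝ) × (ι → C(K, ℝ))) where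
  carrier := {p | ∃ u : D.core, toC u = p.1 ∧
    ∀ h φ, D.gamma u h φ = ∑ i, D.gamma (c i) h (φ * p.2 i)}
  add_mem' := by
    rintro p q ⟨u, hu, hu'⟩ ⟨w, hw, hw'⟩
    refine ⟨u + w, by rw [map_add, hu, hw]; rfl, fun h φ => ?_⟩
    simp only [map_add, LinearMap.add_apply, add_apply, hu', hw', Prod.snd_add, Pi.add_apply,
      mul_add, Finset.sum_add_distrib]
  zero_mem' := ⟨0, map_zero _, fun h φ => by simp⟩
  smul_mem' := by
    rintro r p ⟨u, hu, hu'⟩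
    refine ⟨r • u, by rw [map_smul, hu]; rfl, fun h φ => ?_⟩
    simp only [map_smul, LinearMap.smul_apply, smul_apply, hu', Prod.smul_snd, Pi.smul_apply,
      mul_smul_comm, Finset.smul_sum]

variable {ι : Type*} [Fintype ι] {c : ι → D.core}

lemma one_mem_jetSpace (r : ℝ) :
    ((ContinuousMap.const K r, 0) : C(K, ℝ) × (ι → C(K, ℝ))) ∈ jetSpace c := by
  refine ⟨r • 1, ?_, fun h φ => ?_⟩
  · ext x
    change r * 1 = r
    ring
  · simp [gamma_one_left]

lemma mul_mem_jetSpace {p q : C(K, ℝ) × (ι → C(K, ℝ))} (hp : p ∈ jetSpace c)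
    (hq : q ∈ jetSpace c) :
    ((p.1 * q.1, fun i => p.1 * q.2 i + q.1 * p.2 i) : C(K, ℝ) × (ι → C(K, ℝ))) ∈
      jetSpace c := by
  obtain ⟨u, hu, hu'⟩ := hp
  obtain ⟨w, hw, hw'⟩ := hq
  refine ⟨u * w, by rw [toC_mul, hu, hw], fun h φ => ?_⟩
  rw [gamma_mul_left, hu', hw', ← Finset.sum_add_distrib, hu, hw]
  refine Finset.sum_congr rfl fun i _ => ?_
  rw [← map_add, mul_add, mul_assoc, mul_assoc]

lemma coord_mem_jetSpace [DecidableEq ι] (i : ι) :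
    ((toC (c i), Pi.single i 1) : C(K, ℝ) × (ι → C(K, ℝ))) ∈ jetSpace c := by
  refine ⟨c i, rfl, fun h φ => ?_⟩
  rw [Finset.sum_eq_single i]
  · simp
  · intro j _ hj
    simp [Pi.single_eq_of_ne hj]
  · simp

/-- Testing the jet relation with `h = u` and `φ = 1` bounds E(u, u) by the sup norm of `v` times
one factor of the energy norm of `u`, which is then divided out. -/
lemma coreForm_jet_le {u : D.core} {v : ι → C(K, ℝ)}
    (hu : ∀ h φ, D.gamma u h φ = ∑ i, D.gamma (c i) h (φ * v i)) :
    D.energyNorm u ≤ ‖v‖ * ∑ i, D.energyNorm (c i) := by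
  have h0 := D.energyNorm_nonneg u
  have h1 : D.energyNorm u * D.energyNorm u ≤
      (‖v‖ * ∑ i, D.energyNorm (c i)) * D.energyNorm u := by
    calc D.energyNorm u * D.energyNorm u = ∑ i, D.gamma (c i) u (v i) := by
          rw [← sq, energyNorm_sq, ← gamma_one, hu]
          simp
      _ ≤ ∑ i, ‖v‖ * (D.energyNorm (c i) * D.energyNorm u) := by
          refine Finset.sum_le_sum fun i _ => (le_abs_self _).trans
            ((abs_gamma_le_mul _ _ _).trans ?_)
          have := D.energyNorm_nonneg (c i)
          gcongr
          exact norm_le_pi_norm v i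
      _ = _ := by rw [Finset.mul_sum, Finset.sum_mul]; simp only [mul_assoc]
  rcases h0.eq_or_lt with h | h
  · rw [← h]
    exact mul_nonneg (norm_nonneg _) (Finset.sum_nonneg fun i _ => D.energyNorm_nonneg _)
  · exact le_of_mul_le_mul_right h1 h

/-- By `coreForm_jet_le`, uniform convergence of the gradients makes the functions Cauchy in energy;
closedness of the form then keeps the limit in the core, and both sides of the jet relation pass to
the limit. -/
lemma isClosed_jetSpace : IsClosed (jetSpace c : Set (C(K, ℝ) × (ι → C(K, ℝ)))) := by
  refine IsSeqClosed.isClosed fun p q hp hpq => ?_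
  choose u hu hu' using hp
  set C : ℝ := ∑ i, D.energyNorm (c i) with hC
  have hC0 : 0 ≤ C := Finset.sum_nonneg fun i _ => D.energyNorm_nonneg _
  have hp1 : Tendsto (fun n => (p n).1) atTop (𝓝 q.1) := (continuous_fst.tendsto q).comp hpq
  have hp2 : Tendsto (fun n => (p n).2) atTop (𝓝 q.2) := (continuous_snd.tendsto q).comp hpq
  obtain ⟨hmem, hlim⟩ := exists_core_of_tendsto (D := D) (u := u) (f := q.1) (by
    intro ε hε
    obtain ⟨N, hN⟩ := (Metric.tendsto_atTop.1 hp1) ε hε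
    refine ⟨N, fun n hn x => ?_⟩
    have h1 := hN n hn
    rw [← hu n, dist_eq_norm] at h1
    exact (ContinuousMap.norm_coe_le_norm (toC (u n) - q.1) x).trans h1.le) (by
    intro ε hε
    obtain ⟨N, hN⟩ := (Metric.cauchySeq_iff.1 hp2.cauchySeq) (ε / (C + 1)) (by positivity)
    refine ⟨N, fun k hk l hl => ?_⟩
    have h1 := hN k hk l hl
    rw [dist_eq_norm] at h1
    have h2 := coreForm_jet_le (c := c) (u := u k - u l) (v := (p k).2 - (p l).2) (fun h φ => by
      simp only [map_sub, LinearMap.sub_apply, sub_apply, hu', Pi.sub_apply, mul_sub,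
        Finset.sum_sub_distrib])
    refine h2.trans ?_
    calc _ ≤ ε / (C + 1) * C := by gcongr
      _ ≤ ε := by rw [div_mul_eq_mul_div, div_le_iff₀ (by positivity)]; nlinarith)
  refine ⟨⟨q.1, hmem⟩, rfl, fun h φ => ?_⟩
  have l1 : Tendsto (fun n => D.gamma (u n) h φ) atTop (𝓝 (D.gamma ⟨q.1, hmem⟩ h φ)) := by
    rw [tendsto_iff_norm_sub_tendsto_zero]
    refine squeeze_zero (fun _ => norm_nonneg _) (fun n => ?_)
      (by simpa using (hlim.mul_const (D.energyNorm h)).const_mul ‖φ‖)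
    have h1 := abs_gamma_le_mul (u n - ⟨q.1, hmem⟩) h φ
    rw [Real.norm_eq_abs]
    simpa only [map_sub, LinearMap.sub_apply, sub_apply] using h1
  have l2 : Tendsto (fun n => ∑ i, D.gamma (c i) h (φ * (p n).2 i)) atTop
      (𝓝 (∑ i, D.gamma (c i) h (φ * q.2 i))) :=
    tendsto_finsetSum _ fun i _ => ((D.gamma (c i) h).continuous.tendsto _).comp
      (((continuous_apply i).tendsto _).comp hp2 |>.const_mul φ)
  exact tendsto_nhds_unique l1 (l2.congr fun n => (hu' n h φ).symm)

lemma polynomial_mem_jetSpace (f : D.core) (P : Polynomial ℝ) :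
    ((Polynomial.aeval (toC f) P, fun _ => Polynomial.aeval (toC f) (Polynomial.derivative P)) :
      C(K, ℝ) × (Unit → C(K, ℝ))) ∈ jetSpace fun _ : Unit => f := by
  induction P using Polynomial.induction_on with
  | C a =>
    have := one_mem_jetSpace (c := fun _ : Unit => f) a
    convert this using 1
    ext x <;> simp
  | add p q hp hq =>
    have := (jetSpace fun _ : Unit => f).add_mem hp hq
    convert this using 1
    ext x <;> simp
  | monomial n a ih =>
    have := mul_mem_jetSpace ih (coord_mem_jetSpace (c := fun _ : Unit => f) ())
    rw [pow_succ, ← mul_assoc]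
    generalize Polynomial.C a * Polynomial.X ^ n = p at this ⊢
    convert this using 1
    ext x
    · simp
    · simp [Polynomial.derivative_mul]
      ring

/-- The chain rule for a continuously differentiable function of one element of the core. -/
lemma comp_mem_jetSpace_unit {ψ ψ' : ℝ → ℝ} {a b : ℝ} (hab : a ≤ b)
    (hψ : ∀ t ∈ Set.Icc a b, HasDerivAt ψ (ψ' t) t) (hψ' : ContinuousOn ψ' (Set.Icc a b))
    (f : D.core) (hf : ∀ x, f.1 x ∈ Set.Icc a b) {u v : C(K, ℝ)} (hu : ∀ x, u x = ψ (f.1 x))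
    (hv : ∀ x, v x = ψ' (f.1 x)) :
    ((u, fun _ => v) : C(K, ℝ) × (Unit → C(K, ℝ))) ∈ jetSpace fun _ : Unit => f := by
  have hba := sub_nonneg.2 hab
  rw [← SetLike.mem_coe, ← isClosed_jetSpace.closure_eq, Metric.mem_closure_iff]
  intro ε hε
  -- A δ-approximation of the derivative costs δ in the gradient and at most δ(b - a) in the
  -- function; both have to stay below ε/2.
  set δ : ℝ := ε / (2 * (b - a + 1)) with hδ
  have hδ0 : 0 < δ := by positivity
  have hδ1 : δ * (b - a) ≤ ε / 2 := by
    rw [hδ, div_mul_eq_mul_div, div_le_div_iff₀ (by positivity) (by positivity)]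
    nlinarith
  have hδ2 : δ ≤ ε / 2 := by
    rw [hδ, div_le_div_iff₀ (by positivity) (by positivity)]
    nlinarith
  obtain ⟨p, hp⟩ := exists_polynomial_near_of_continuousOn a b ψ' hψ' δ hδ0
  obtain ⟨P, hP⟩ := Polynomial.exists_derivative_eq p
  -- The antiderivative is normalized to agree with `ψ` at `a`, where the mean value estimate
  -- starts.
  set Q := P + Polynomial.C (ψ a - P.eval a) with hQ
  have hQ' : Polynomial.derivative Q = p := by simp [hQ, hP]
  have hQa : Q.eval a = ψ a := by simp [hQ]
  have hev : ∀ (R : Polynomial ℝ) x, Polynomial.aeval (toC f : C(K, ℝ)) R x = R.eval (f.1 x) := by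
    intro R x
    simp [Polynomial.aeval_continuousMap_apply]
  refine ⟨_, polynomial_mem_jetSpace f Q, ?_⟩
  rw [hQ', dist_eq_norm]
  refine lt_of_le_of_lt (b := ε / 2) ?_ (by linarith)
  refine max_le ?_ ?_
  · rw [ContinuousMap.norm_le _ (by positivity)]
    intro x
    have hx := hf x
    change ‖u x - Polynomial.aeval (toC f : C(K, ℝ)) Q x‖ ≤ ε / 2
    rw [hev, hu]
    have h1 := Convex.norm_image_sub_le_of_norm_hasDerivWithin_le
      (f := fun t => ψ t - Q.eval t) (f' := fun t => ψ' t - p.eval t) (C := δ)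
      (s := Set.Icc a b) (x := a) (y := f.1 x)
      (fun t ht => by
        have := Q.hasDerivAt t
        rw [hQ'] at this
        exact ((hψ t ht).sub this).hasDerivWithinAt)
      (fun t ht => by rw [norm_sub_rev]; exact (hp t ht).le) (convex_Icc a b) ⟨le_rfl, hab⟩ hx
    simp only [hQa, sub_self, sub_zero] at h1
    refine h1.trans (le_trans ?_ hδ1)
    rw [Real.norm_eq_abs, abs_of_nonneg (sub_nonneg.2 hx.1)]
    gcongr
    exact hx.2
  · rw [pi_norm_le_iff_of_nonneg (by positivity)]
    intro _
    rw [ContinuousMap.norm_le _ (by positivity)]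
    intro x
    change ‖v x - Polynomial.aeval (toC f : C(K, ℝ)) p x‖ ≤ ε / 2
    rw [hev, hv, norm_sub_rev]
    exact (hp _ (hf x)).le.trans hδ2

lemma comp_mem_jetSpace {ψ ψ' : ℝ → ℝ} (hψ : ∀ t, HasDerivAt ψ (ψ' t) t) (hψ' : Continuous ψ')
    {p : C(K, ℝ) × (ι → C(K, ℝ))} (hp : p ∈ jetSpace c) {u : C(K, ℝ)} {v : ι → C(K, ℝ)}
    (hu : ∀ x, u x = ψ (p.1 x)) (hv : ∀ i x, v i x = ψ' (p.1 x) * p.2 i x) :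
    (u, v) ∈ jetSpace c := by
  obtain ⟨f, hf, hf'⟩ := hp
  obtain ⟨M, hM, hfM⟩ := exists_bound f.1 f.2.1
  have hfp : ∀ x, p.1 x = f.1 x := fun x => by rw [← hf]; rfl
  obtain ⟨w, hw, hw'⟩ := comp_mem_jetSpace_unit (a := -M) (b := M) (by linarith)
    (fun t _ => hψ t) hψ'.continuousOn f (fun x => abs_le.1 (hfM x)) (u := u)
    (v := ⟨fun x => ψ' (p.1 x), by fun_prop⟩) (fun x => by rw [hu, hfp])
    (fun x => by rw [← hfp]; rfl)
  refine ⟨w, hw, fun h φ => ?_⟩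
  rw [hw', Fintype.sum_unique, hf']
  refine Finset.sum_congr rfl fun i _ => ?_
  congr 1
  ext x
  simp only [ContinuousMap.mul_apply, hv, ContinuousMap.coe_mk]
  ring

end Chain

end DirichletForm

/-! ### Closed subspaces under integration, and mollification by radial bumps -/

lemma Submodule.integral_mem_of_isClosed {α E : Type*} [MeasurableSpace α] {ν : Measure α}
    [NormedAddCommGroup E] [NormedSpace ℝ E] [CompleteSpace E] (S : Submodule ℝ E)
    (hS : IsClosed (S : Set E)) {f : α → E} (hf : Integrable f ν) (hfS : ∀ a, f a ∈ S) :
    ∫ a, f a ∂ν ∈ S := by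
  have : IsClosed (S : Set E) := hS
  have h := S.mkQL.integral_comp_comm hf
  have h0 : ∀ a, S.mkQL (f a) = 0 := fun a => (Submodule.Quotient.mk_eq_zero S).2 (hfS a)
  simp only [h0, integral_zero] at h
  exact (Submodule.Quotient.mk_eq_zero S).1 h.symm

section Kernel

variable {m : ℕ}

/-- A smooth radial bump function supported in the ball of radius `r`. -/
def radialBump (r : ℝ) (z : EuclideanSpace ℝ (Fin m)) : ℝ :=
  Real.smoothTransition (1 - ‖z‖ ^ 2 / r ^ 2)

lemma contDiff_radialBump (r : ℝ) : ContDiff ℝ 1 (radialBump (m := m) r) :=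
  Real.smoothTransition.contDiff.comp
    (contDiff_const.sub ((contDiff_norm_sq ℝ).div_const _))

lemma radialBump_nonneg (r : ℝ) (z : EuclideanSpace ℝ (Fin m)) : 0 ≤ radialBump r z :=
  Real.smoothTransition.nonneg _

lemma support_radialBump {r : ℝ} (hr : 0 < r) :
    Function.support (radialBump (m := m) r) ⊆ Metric.ball 0 r := by
  intro z hz
  rw [mem_ball_zero_iff]
  by_contra! h
  refine hz (Real.smoothTransition.zero_of_nonpos ?_)
  rw [sub_nonpos, one_le_div (by positivity)]
  gcongr

lemma hasCompactSupport_radialBump {r : ℝ} (hr : 0 < r) :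
    HasCompactSupport (radialBump (m := m) r) :=
  HasCompactSupport.of_support_subset_isCompact (isCompact_closedBall 0 r)
    ((support_radialBump hr).trans Metric.ball_subset_closedBall)

lemma integral_radialBump_pos {r : ℝ} (hr : 0 < r) :
    0 < ∫ z, radialBump (m := m) r z :=
  (contDiff_radialBump r).continuous.integral_pos_of_hasCompactSupport_nonneg_nonzero
    (hasCompactSupport_radialBump hr) (radialBump_nonneg r) (x := 0)
    (by simp [radialBump])

lemma contDiff_dForm_continuous {F : EuclideanSpace ℝ (Fin m) → ℝ} (hF : ContDiff ℝ 1 F)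
    (i : Fin m) : Continuous (dForm F i) :=
  (hF.continuous_fderiv one_ne_zero).clm_apply continuous_const

lemma hasCompactSupport_dForm {F : EuclideanSpace ℝ (Fin m) → ℝ} (hF : HasCompactSupport F)
    (i : Fin m) : HasCompactSupport (dForm F i) :=
  hF.fderiv_apply (𝕜 := ℝ) _

lemma dForm_radialBump (r : ℝ) (i : Fin m) (z : EuclideanSpace ℝ (Fin m)) :
    dForm (radialBump r) i z =
      deriv (fun s : ℝ => Real.smoothTransition (1 - s / r ^ 2)) (‖z‖ ^ 2) * (2 * z i) := by
  have h1 : HasDerivAt (fun s : ℝ => Real.smoothTransition (1 - s / r ^ 2))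
      (deriv (fun s : ℝ => Real.smoothTransition (1 - s / r ^ 2)) (‖z‖ ^ 2)) (‖z‖ ^ 2) := by
    have : ContDiff ℝ 1 (fun s : ℝ => Real.smoothTransition (1 - s / r ^ 2)) :=
      Real.smoothTransition.contDiff.comp (contDiff_const.sub (contDiff_id.div_const _))
    exact (this.differentiable one_ne_zero _).hasDerivAt
  have h2 := h1.comp_hasFDerivAt z (hasStrictFDerivAt_norm_sq z).hasFDerivAt
  unfold dForm
  have h3 : fderiv ℝ (radialBump r) z = _ := h2.fderiv
  rw [h3]
  simp [EuclideanSpace.inner_single_right]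

/-- A compactly supported continuous function is uniformly continuous, so averaging it over a small
enough ball moves it little, uniformly in `x`. -/
lemma eventually_mollify {G : EuclideanSpace ℝ (Fin m) → ℝ} (hG : Continuous G)
    (hG' : HasCompactSupport G) {ε : ℝ} (hε : 0 < ε) :
    ∀ᶠ r in 𝓝[>] (0 : ℝ), ∀ x,
      |(∫ z, radialBump (m := m) r z)⁻¹ * (∫ y, G y * radialBump r (x - y)) - G x| ≤ ε := by
  obtain ⟨δ, hδ, h⟩ := Metric.uniformContinuous_iff.1
    (hG.uniformContinuous_of_tendsto_cocompact hG'.is_zero_at_infty) ε hε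
  filter_upwards [self_mem_nhdsWithin, Ioo_mem_nhdsGT hδ] with r hr hrδ x
  have hr : 0 < r := hr
  have hc := integral_radialBump_pos (m := m) hr
  set c : ℝ := ∫ z, radialBump (m := m) r z with hcdef
  have := dist_convolution_le (μ := volume) (f := fun z => c⁻¹ * radialBump r z) (g := G) (x₀ := x)
    (z₀ := G x) (R := r) hε.le
    (fun z hz => support_radialBump hr (right_ne_zero_of_mul hz))
    (fun z => mul_nonneg (inv_nonneg.2 hc.le) (radialBump_nonneg r z))
    (by rw [integral_const_mul, inv_mul_cancel₀ hc.ne']) hG.aestronglyMeasurable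
    (fun y hy => (h ((Metric.mem_ball.1 hy).trans hrδ.2)).le)
  rw [convolution_lsmul_swap, Real.dist_eq] at this
  rw [← integral_const_mul]
  have e : (fun y => c⁻¹ * (G y * radialBump r (x - y))) =
      fun y => (c⁻¹ * radialBump r (x - y)) • G y := by
    ext y
    rw [smul_eq_mul]
    ring
  rw [e]
  exact this

lemma integral_mul_dForm_radialBump {F : EuclideanSpace ℝ (Fin m) → ℝ} (hF : ContDiff ℝ 1 F)
    (hF' : HasCompactSupport F) (r : ℝ) (i : Fin m) (x : EuclideanSpace ℝ (Fin m)) :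
    ∫ y, F y * dForm (radialBump r) i (x - y) = ∫ y, dForm F i y * radialBump r (x - y) := by
  have hk := contDiff_radialBump (m := m) r
  have hd : ∀ y, HasFDerivAt (fun y => radialBump r (x - y))
      ((fderiv ℝ (radialBump r) (x - y)).comp
        (-(ContinuousLinearMap.id ℝ (EuclideanSpace ℝ (Fin m))))) y := fun y =>
    ((hk.differentiable one_ne_zero) (x - y)).hasFDerivAt.comp y
      ((hasFDerivAt_id y).const_sub x)
  have hd' : ∀ y, fderiv ℝ (fun y => radialBump r (x - y)) y (EuclideanSpace.single i 1) =
      -dForm (radialBump r) i (x - y) := fun y => by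
    rw [(hd y).fderiv]
    simp [dForm]
  have c1 := hk.continuous
  have c2 := contDiff_dForm_continuous hk i
  have c3 := contDiff_dForm_continuous hF i
  have c4 := hF.continuous
  have h := integral_mul_fderiv_eq_neg_fderiv_mul_of_integrable (μ := volume) (f := F)
    (g := fun y => radialBump r (x - y)) (v := EuclideanSpace.single i 1)
    (Continuous.integrable_of_hasCompactSupport
      (f := fun y => dForm F i y * radialBump r (x - y)) (by fun_prop)
      (hasCompactSupport_dForm hF' i).mul_right)
    (by
      simp only [hd']
      exact Continuous.integrable_of_hasCompactSupport (by fun_prop) hF'.mul_right)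
    (Continuous.integrable_of_hasCompactSupport (by fun_prop) hF'.mul_right)
    (fun y _ => hF.differentiable one_ne_zero y) (fun y _ => (hd y).differentiableAt)
  simp only [hd', mul_neg, integral_neg, neg_inj] at h
  exact h

end Kernel

namespace DirichletForm

/-! ### The chain rule in several variables -/

section Chain

variable {K : Type*} [TopologicalSpace K] [CompactSpace K] [T2Space K] [MeasurableSpace K]
  [BorelSpace K] {μ : Measure K} [IsFiniteMeasure μ] {D : DirichletForm μ} [D.UnitalLocal]
  {m : ℕ} (φ : Fin m → D.core)

lemma continuous_coordMap {K : Type*} [TopologicalSpace K] [MeasurableSpace K] {μ : Measure K}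
    {D : DirichletForm μ} {m : ℕ} (φ : Fin m → D.core) : Continuous (D.coordMap φ) :=
  (PiLp.continuous_toLp 2 _).comp (continuous_pi fun i => (φ i).2.1)

lemma coordMap_apply {K : Type*} [TopologicalSpace K] [MeasurableSpace K] {μ : Measure K}
    {D : DirichletForm μ} {m : ℕ} (φ : Fin m → D.core) (x : K) (i : Fin m) :
    D.coordMap φ x i = (φ i).1 x := rfl

/-- The pullback along the coordinates of the translates of a function, as a continuous family. -/
def translates {G : EuclideanSpace ℝ (Fin m) → ℝ} (hG : Continuous G) :
    C(EuclideanSpace ℝ (Fin m), C(K, ℝ)) :=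
  ContinuousMap.curry
    ⟨fun p => G (D.coordMap φ p.2 - p.1), by
      have := continuous_coordMap φ
      fun_prop⟩

/-- The pullbacks of a translate of `radialBump r` and of its partial derivatives. -/
def bumpJet (r : ℝ) (y : EuclideanSpace ℝ (Fin m)) : C(K, ℝ) × (Fin m → C(K, ℝ)) :=
  (translates φ (contDiff_radialBump r).continuous y,
    fun i => translates φ (contDiff_dForm_continuous (contDiff_radialBump r) i) y)

lemma continuous_bumpJet (r : ℝ) : Continuous (bumpJet φ r) :=
  (ContinuousMap.continuous _).prodMk (continuous_pi fun _ => ContinuousMap.continuous _)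

/-- A radial bump is a C¹ function of ‖Φ - y‖², a polynomial in the coordinates, so stability under
products and one-variable composition suffices. -/
lemma bumpJet_mem (r : ℝ) (y : EuclideanSpace ℝ (Fin m)) : bumpJet φ r y ∈ jetSpace φ := by
  classical
  have hq : ∀ i, ((toC (φ i) - ContinuousMap.const K (y i), Pi.single i 1) :
      C(K, ℝ) × (Fin m → C(K, ℝ))) ∈ jetSpace φ := fun i => by
    have := (jetSpace φ).sub_mem (coord_mem_jetSpace i) (one_mem_jetSpace (c := φ) (y i))
    simpa using this
  have hp := (jetSpace φ).sum_mem (t := Finset.univ) fun i _ => mul_mem_jetSpace (hq i) (hq i)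
  have hθ : ContDiff ℝ 1 (fun s : ℝ => Real.smoothTransition (1 - s / r ^ 2)) :=
    Real.smoothTransition.contDiff.comp (contDiff_const.sub (contDiff_id.div_const _))
  have h1 : ∀ x, ‖D.coordMap φ x - y‖ ^ 2 = ∑ i, ((φ i).1 x - y i) * ((φ i).1 x - y i) := by
    intro x
    rw [EuclideanSpace.norm_sq_eq]
    refine Finset.sum_congr rfl fun i _ => ?_
    rw [Real.norm_eq_abs, sq_abs, sq]
    rfl
  have h2 : ∀ x, (∑ i : Fin m, (toC (φ i) - ContinuousMap.const K (y i)) *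
      (toC (φ i) - ContinuousMap.const K (y i))) x = ‖D.coordMap φ x - y‖ ^ 2 := by
    intro x
    rw [h1, ContinuousMap.sum_apply]
    rfl
  refine comp_mem_jetSpace (fun t => (hθ.differentiable one_ne_zero t).hasDerivAt)
    (hθ.continuous_deriv le_rfl) hp (fun x => ?_) (fun i x => ?_)
  · rw [Prod.fst_sum, h2]
    rfl
  · rw [Prod.fst_sum, h2]
    change dForm (radialBump r) i (D.coordMap φ x - y) = _
    rw [dForm_radialBump, Prod.snd_sum, Finset.sum_apply, ContinuousMap.sum_apply,
      Finset.sum_eq_single i]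
    · simp [coordMap_apply, two_mul, -mul_eq_mul_left_iff]
    · intro j _ hj
      simp [Pi.single_eq_of_ne hj.symm]
    · simp

/-- The pullbacks along the coordinates of a `C¹` function and of its partial derivatives. -/
def jet {F : EuclideanSpace ℝ (Fin m) → ℝ} (hF : ContDiff ℝ 1 F) :
    C(K, ℝ) × (Fin m → C(K, ℝ)) :=
  (⟨fun x => F (D.coordMap φ x), hF.continuous.comp (continuous_coordMap φ)⟩,
    fun i => ⟨fun x => dForm F i (D.coordMap φ x),
      (contDiff_dForm_continuous hF i).comp (continuous_coordMap φ)⟩)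

/-- The chain rule for a compactly supported `C¹` function of the coordinates. -/
lemma jet_mem {F : EuclideanSpace ℝ (Fin m) → ℝ} (hF : ContDiff ℝ 1 F)
    (hF' : HasCompactSupport F) : jet φ hF ∈ jetSpace φ := by
  rw [← SetLike.mem_coe, ← (isClosed_jetSpace (c := φ)).closure_eq, Metric.mem_closure_iff]
  intro ε hε
  have e1 := eventually_mollify hF.continuous hF' (half_pos hε)
  have e2 := fun i => eventually_mollify (contDiff_dForm_continuous hF i)
    (hasCompactSupport_dForm hF' i) (half_pos hε)
  obtain ⟨r, hr1, hr2⟩ := (e1.and (eventually_all.2 e2)).exists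
  have hint : Integrable fun y => F y • bumpJet φ r y := by
    refine Continuous.integrable_of_hasCompactSupport
      (hF.continuous.smul (continuous_bumpJet φ r)) ?_
    exact hF'.smul_right
  set c : ℝ := ∫ z, radialBump (m := m) r z with hc
  -- The approximant is a Bochner integral of elements of the closed subspace; evaluation at a point
  -- shows it to be the mollification of `F` paired with the gradient of that mollification.
  refine ⟨c⁻¹ • ∫ y, F y • bumpJet φ r y, (jetSpace φ).smul_mem _
    ((jetSpace φ).integral_mem_of_isClosed isClosed_jetSpace hint
      fun y => (jetSpace φ).smul_mem _ (bumpJet_mem φ r y)), ?_⟩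
  have i1 : ∀ x, (∫ y, F y • bumpJet φ r y).1 x =
      ∫ y, F y * radialBump r (D.coordMap φ x - y) := fun x =>
    (((ContinuousMap.evalCLM ℝ x).comp
      (ContinuousLinearMap.fst ℝ C(K, ℝ) (Fin m → C(K, ℝ)))).integral_comp_comm hint).symm
  have i2 : ∀ i x, (∫ y, F y • bumpJet φ r y).2 i x =
      ∫ y, F y * dForm (radialBump r) i (D.coordMap φ x - y) := fun i x =>
    (((ContinuousMap.evalCLM ℝ x).comp ((ContinuousLinearMap.proj i).comp
      (ContinuousLinearMap.snd ℝ C(K, ℝ) (Fin m → C(K, ℝ))))).integral_comp_comm hint).symm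
  rw [dist_comm, dist_eq_norm]
  refine lt_of_le_of_lt (b := ε / 2) (max_le ?_ ?_) (by linarith)
  · rw [ContinuousMap.norm_le _ (by positivity)]
    intro x
    change |c⁻¹ * (∫ y, F y • bumpJet φ r y).1 x - F (D.coordMap φ x)| ≤ ε / 2
    rw [i1]
    exact hr1 _
  · rw [pi_norm_le_iff_of_nonneg (by positivity)]
    intro i
    rw [ContinuousMap.norm_le _ (by positivity)]
    intro x
    change |c⁻¹ * (∫ y, F y • bumpJet φ r y).2 i x - dForm F i (D.coordMap φ x)| ≤ ε / 2
    -- Integration by parts moves the derivative from the kernel to `F`, so the gradient component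
    -- is a mollification of the partial derivative.
    rw [i2, integral_mul_dForm_radialBump hF hF']
    exact hr2 i _

end Chain

end DirichletForm

/-! ### Signed densities against continuous functions -/

section Densities

variable {K : Type*} [MeasurableSpace K] {μ : Measure K}

lemma measureReal_withDensity_ofReal {ρ : K → ℝ} (hρ : Integrable ρ μ) {A : Set K}
    (hA : MeasurableSet A) :
    (μ.withDensity fun x => ENNReal.ofReal (ρ x)).real A = ∫ x in A, max (ρ x) 0 ∂μ := by
  rw [measureReal_def, withDensity_apply _ hA, ← integral_toReal
    hρ.aestronglyMeasurable.aemeasurable.ennreal_ofReal.restrict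
    (Eventually.of_forall fun _ => ENNReal.ofReal_lt_top)]
  simp only [ENNReal.toReal_ofReal']

lemma integral_withDensity_ofReal {ρ : K → ℝ} (hρ : Integrable ρ μ) (g : K → ℝ) :
    ∫ x, g x ∂(μ.withDensity fun x => ENNReal.ofReal (ρ x)) = ∫ x, g x * max (ρ x) 0 ∂μ := by
  rw [integral_withDensity_eq_integral_toReal_smul₀
    hρ.aestronglyMeasurable.aemeasurable.ennreal_ofReal
    (Eventually.of_forall fun _ => ENNReal.ofReal_lt_top)]
  simp only [ENNReal.toReal_ofReal', smul_eq_mul, mul_comm]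

lemma isFiniteMeasure_withDensity_ofReal' {ρ : K → ℝ} (hρ : Integrable ρ μ) :
    IsFiniteMeasure (μ.withDensity fun x => ENNReal.ofReal (ρ x)) :=
  isFiniteMeasure_withDensity_ofReal hρ.2

variable [TopologicalSpace K] [CompactSpace K] [BorelSpace K]

lemma integrable_continuous (P : Measure K) [IsFiniteMeasure P] (g : C(K, ℝ)) :
    Integrable g P :=
  g.continuous.integrable_of_hasCompactSupport (HasCompactSupport.of_compactSpace _)

lemma integrable_continuous_mul {ρ : K → ℝ} (hρ : Integrable ρ μ) (g : C(K, ℝ)) :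
    Integrable (fun x => g x * ρ x) μ :=
  hρ.bdd_mul g.continuous.aestronglyMeasurable (Eventually.of_forall g.norm_coe_le_norm)

lemma integral_sub_integral_eq {P N : Measure K} [IsFiniteMeasure P] [IsFiniteMeasure N]
    {ρ : K → ℝ} (hρ : Integrable ρ μ)
    (h : ∀ A, MeasurableSet A → P.real A - N.real A = ∫ x in A, ρ x ∂μ) (g : C(K, ℝ)) :
    ∫ x, g x ∂P - ∫ x, g x ∂N = ∫ x, g x * ρ x ∂μ := by
  have f1 := isFiniteMeasure_withDensity_ofReal' hρ
  have f2 := isFiniteMeasure_withDensity_ofReal' hρ.neg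
  have hmax : ∀ x, ρ x = max (ρ x) 0 - max ((-ρ) x) 0 := fun x => by
    rw [Pi.neg_apply, max_comm (-ρ x), ← max_zero_sub_eq_self (ρ x)]
    simp [max_comm]
  -- The signed identity P - N = ρ μ is rearranged into an equality of two positive finite measures,
  -- which can be integrated against `g`.
  have hm : P + μ.withDensity (fun x => ENNReal.ofReal ((-ρ) x)) =
      N + μ.withDensity (fun x => ENNReal.ofReal (ρ x)) := by
    ext A hA
    rw [← measureReal_eq_measureReal_iff, measureReal_add_apply, measureReal_add_apply,
      measureReal_withDensity_ofReal hρ hA, measureReal_withDensity_ofReal hρ.neg hA]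
    have h1 := h A hA
    have h2 : ∫ x in A, ρ x ∂μ = ∫ x in A, max (ρ x) 0 ∂μ - ∫ x in A, max ((-ρ) x) 0 ∂μ := by
      rw [← integral_sub hρ.pos_part.integrableOn hρ.neg.pos_part.integrableOn]
      exact integral_congr_ae (Eventually.of_forall hmax)
    linarith
  have h1 : ∫ x, g x ∂(P + μ.withDensity (fun x => ENNReal.ofReal ((-ρ) x))) =
      ∫ x, g x ∂(N + μ.withDensity (fun x => ENNReal.ofReal (ρ x))) := by rw [hm]
  rw [integral_add_measure (integrable_continuous _ g) (integrable_continuous _ g),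
    integral_add_measure (integrable_continuous _ g) (integrable_continuous _ g),
    integral_withDensity_ofReal hρ, integral_withDensity_ofReal hρ.neg] at h1
  have h2 : ∫ x, g x * ρ x ∂μ =
      ∫ x, g x * max (ρ x) 0 ∂μ - ∫ x, g x * max ((-ρ) x) 0 ∂μ := by
    rw [← integral_sub (integrable_continuous_mul hρ.pos_part g)
      (integrable_continuous_mul hρ.neg.pos_part g)]
    refine integral_congr_ae (Eventually.of_forall fun x => ?_)
    change g x * ρ x = g x * max (ρ x) 0 - g x * max ((-ρ) x) 0
    rw [← mul_sub, ← hmax]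
  linarith

/-- The positive and negative parts of ρ define finite measures with equal integrals of continuous
functions; such measures coincide. -/
lemma ae_eq_zero_of_forall_integral_continuous_mul [T2Space K] [HasOuterApproxClosed K]
    {ρ : K → ℝ} (hρ : Integrable ρ μ) (h : ∀ g : C(K, ℝ), ∫ x, g x * ρ x ∂μ = 0) :
    ρ =ᵐ[μ] 0 := by
  have f1 := isFiniteMeasure_withDensity_ofReal' hρ
  have f2 := isFiniteMeasure_withDensity_ofReal' hρ.neg
  have hmax : ∀ x, ρ x = max (ρ x) 0 - max ((-ρ) x) 0 := fun x => by
    rw [Pi.neg_apply, max_comm (-ρ x), ← max_zero_sub_eq_self (ρ x)]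
    simp [max_comm]
  have hset : ∀ A, MeasurableSet A → (μ.withDensity fun x => ENNReal.ofReal (ρ x)).real A -
      (μ.withDensity fun x => ENNReal.ofReal ((-ρ) x)).real A = ∫ x in A, ρ x ∂μ := by
    intro A hA
    rw [measureReal_withDensity_ofReal hρ hA, measureReal_withDensity_ofReal hρ.neg hA,
      ← integral_sub hρ.pos_part.integrableOn hρ.neg.pos_part.integrableOn]
    exact integral_congr_ae (Eventually.of_forall fun x => (hmax x).symm)
  have hm : μ.withDensity (fun x => ENNReal.ofReal (ρ x)) =
      μ.withDensity (fun x => ENNReal.ofReal ((-ρ) x)) := by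
    refine ext_of_forall_integral_eq_of_IsFiniteMeasure fun g => ?_
    have h1 := integral_sub_integral_eq hρ hset g.toContinuousMap
    rw [h] at h1
    exact sub_eq_zero.1 h1
  refine hρ.ae_eq_zero_of_forall_setIntegral_eq_zero fun A hA _ => ?_
  rw [← hset A hA, hm, sub_self]

end Densities

namespace DirichletForm

/-! ### The claims about a coordinate sequence -/

section Coordinates

variable {K : Type*} [MetricSpace K] [CompactSpace K] [MeasurableSpace K] [BorelSpace K]
  {μ : Measure K} [IsFiniteMeasure μ] {D : DirichletForm μ} [D.UnitalLocal]
  {m : ℕ} {φ : Fin m → D.core}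

lemma integrable_Z (hφ : D.IsCoordinateSequence φ) (i j : Fin m) :
    Integrable (fun x => D.Z φ x i j) μ :=
  memLp_one_iff_integrable.1 (hφ.memLp_one i j)

lemma gamma_eq_integral_Z (hφ : D.IsCoordinateSequence φ) (i j : Fin m) (g : C(K, ℝ)) :
    D.gamma (φ i) (φ j) g = ∫ x, g x * D.Z φ x i j ∂μ := by
  have hint := integrable_Z hφ i j
  have hd := (SignedMeasure.withDensityᵥ_rnDeriv_eq (D.mutualEnergyMeasure (φ i) (φ j)) μ
    (hφ.absolutelyContinuous i j)).symm
  have h := integral_sub_integral_eq (P := D.energyMeasure (φ i + φ j))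
    -- The factor 4 undoes the ¼ in the definition of the mutual energy measure.
    (N := D.energyMeasure (φ i - φ j)) (hint.const_mul 4) (fun A hA => by
      have h1 : D.mutualEnergyMeasure (φ i) (φ j) A = ∫ x in A, D.Z φ x i j ∂μ := by
        conv_lhs => rw [hd]
        exact withDensityᵥ_apply hint hA
      rw [mutualEnergyMeasure, smul_apply, sub_apply,
        Measure.toSignedMeasure_apply_measurable hA,
        Measure.toSignedMeasure_apply_measurable hA, smul_eq_mul] at h1
      rw [integral_const_mul, ← h1]
      ring) g
  rw [gamma_eq, mutualEnergyIntegral, h, ← integral_const_mul]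
  refine integral_congr_ae (Eventually.of_forall fun x => ?_)
  change 1 / 4 * (g x * (4 * D.Z φ x i j)) = g x * D.Z φ x i j
  ring

lemma Z_symm_ae (hφ : D.IsCoordinateSequence φ) (i j : Fin m) :
    ∀ᵐ x ∂μ, D.Z φ x i j = D.Z φ x j i := by
  have hi := integrable_Z hφ i j
  have hj := integrable_Z hφ j i
  have h := ae_eq_zero_of_forall_integral_continuous_mul (hi.sub hj) fun g => by
    have : ∀ x, g x * ((fun x => D.Z φ x i j) - fun x => D.Z φ x j i) x =
        g x * D.Z φ x i j - g x * D.Z φ x j i := fun x => mul_sub _ _ _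
    simp only [this]
    rw [integral_sub (integrable_continuous_mul hi g) (integrable_continuous_mul hj g),
      ← gamma_eq_integral_Z hφ, ← gamma_eq_integral_Z hφ, gamma_comm, sub_self]
  filter_upwards [h] with x hx
  exact sub_eq_zero.1 hx

variable {U : Set (EuclideanSpace ℝ (Fin m))}

/-- A continuous function on a neighbourhood of the image of the coordinates, pulled back. -/
def pullback (hKU : Set.range (D.coordMap φ) ⊆ U) {g : EuclideanSpace ℝ (Fin m) → ℝ}
    (hg : ContinuousOn g U) : C(K, ℝ) :=
  ⟨g ∘ D.coordMap φ, hg.comp_continuous (continuous_coordMap φ) fun x => hKU ⟨x, rfl⟩⟩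

lemma seminormZ_sq (hφ : D.IsCoordinateSequence φ) (hKU : Set.range (D.coordMap φ) ⊆ U)
    {ω : Fin m → EuclideanSpace ℝ (Fin m) → ℝ} (hω : IsContForm U ω) :
    (∀ i j, Integrable
        (fun x => ω i (D.coordMap φ x) * D.Z φ x i j * ω j (D.coordMap φ x)) μ) ∧
      D.seminormZ φ ω ^ 2 =
        ∫ x, ∑ i, ∑ j, ω i (D.coordMap φ x) * D.Z φ x i j * ω j (D.coordMap φ x) ∂μ := by
  have e : ∀ i j x, (pullback hKU (hω i) * pullback hKU (hω j)) x * D.Z φ x i j =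
      ω i (D.coordMap φ x) * D.Z φ x i j * ω j (D.coordMap φ x) := fun i j x =>
    mul_right_comm _ _ _
  have hint : ∀ i j, Integrable
      (fun x => ω i (D.coordMap φ x) * D.Z φ x i j * ω j (D.coordMap φ x)) μ := fun i j => by
    have := integrable_continuous_mul (integrable_Z hφ i j)
      (pullback hKU (hω i) * pullback hKU (hω j))
    simpa only [e] using this
  refine ⟨hint, ?_⟩
  have h := norm_sum_tensor_sq φ fun i => pullback hKU (hω i)
  change D.seminormZ φ ω ^ 2 = _ at h
  rw [h, integral_finsetSum _ fun i _ => integrable_finsetSum _ fun j _ => hint i j]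
  refine Finset.sum_congr rfl fun i _ => ?_
  rw [integral_finsetSum _ fun j _ => hint i j]
  refine Finset.sum_congr rfl fun j _ => ?_
  rw [gamma_eq_integral_Z hφ]
  simp only [e]

lemma isContForm_dForm {f : EuclideanSpace ℝ (Fin m) → ℝ} (hU : IsOpen U)
    (hf : ContDiffOn ℝ 1 f U) : IsContForm U (dForm f) := fun _ =>
  (hf.continuousOn_fderiv_of_isOpen hU le_rfl).clm_apply continuousOn_const

/-- Multiplication by a cut-off equal to 1 near `L`. Agreement on neighbourhoods, not just on `L`,
transfers the derivatives as well. -/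
lemma exists_contDiff_eventuallyEq {L : Set (EuclideanSpace ℝ (Fin m))} (hL : IsCompact L)
    (hU : IsOpen U) (hLU : L ⊆ U) {f : EuclideanSpace ℝ (Fin m) → ℝ} (hf : ContDiffOn ℝ 1 f U) :
    ∃ F : EuclideanSpace ℝ (Fin m) → ℝ, ContDiff ℝ 1 F ∧ HasCompactSupport F ∧
      ∀ p ∈ L, F =ᶠ[𝓝 p] f := by
  obtain ⟨L', hL', hLL', hL'U⟩ := exists_compact_between hL hU hLU
  obtain ⟨χ, hχ1, hχ0, -⟩ := exists_contMDiffMap_one_nhds_of_subset_interior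
    (modelWithCornersSelf ℝ (EuclideanSpace ℝ (Fin m))) (n := 1) hL.isClosed hLL'
  have hχ : ContDiff ℝ 1 χ := χ.contMDiff.contDiff
  refine ⟨fun x => χ x * f x, ?_, ?_, fun p hp => ?_⟩
  · rw [contDiff_iff_contDiffAt]
    intro x
    by_cases hx : x ∈ L'
    · exact hχ.contDiffAt.mul (hf.contDiffAt (hU.mem_nhds (hL'U hx)))
    · refine (contDiffAt_const (c := (0 : ℝ))).congr_of_eventuallyEq ?_
      filter_upwards [hL'.isClosed.isOpen_compl.mem_nhds hx] with y hy
      rw [hχ0 y hy, zero_mul]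
  · refine HasCompactSupport.intro hL' fun x hx => ?_
    rw [hχ0 x hx, zero_mul]
  · filter_upwards [(eventually_nhdsSet_iff_forall.1 hχ1) p hp] with x hx
    rw [hx, one_mul]

/-- The chain rule for `C¹` functions of the coordinates. -/
lemma exists_core_chain_rule (hU : IsOpen U) (hKU : Set.range (D.coordMap φ) ⊆ U)
    {f : EuclideanSpace ℝ (Fin m) → ℝ} (hf : ContDiffOn ℝ 1 f U) :
    ∃ u : D.core, u.1 = f ∘ D.coordMap φ ∧ ∀ h ψ, D.gamma u h ψ =
      ∑ i, D.gamma (φ i) h (ψ * pullback hKU (isContForm_dForm hU hf i)) := by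
  obtain ⟨F, hF, hF', hFf⟩ := exists_contDiff_eventuallyEq
    (isCompact_range (continuous_coordMap φ)) hU hKU hf
  obtain ⟨u, hu, hu'⟩ := jet_mem φ hF hF'
  have hFf' : ∀ x, F =ᶠ[𝓝 (D.coordMap φ x)] f := fun x => hFf _ ⟨x, rfl⟩
  refine ⟨u, ?_, fun h ψ => ?_⟩
  · ext x
    have : toC u x = (jet φ hF).1 x := by rw [hu]
    exact this.trans (hFf' x).self_of_nhds
  · have : ∀ i, (jet φ hF).2 i = pullback hKU (isContForm_dForm hU hf i) := by
      intro i
      ext x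
      change dForm F i _ = dForm f i _
      unfold dForm
      rw [(hFf' x).fderiv_eq]
    simp only [hu', this]

/-- Applying the chain rule in both arguments of E(u, u) = Γ(u, u)(1) produces the double sum that
computes the squared norm. -/
lemma seminormZ_dForm_sq (hU : IsOpen U) (hKU : Set.range (D.coordMap φ) ⊆ U)
    {f : EuclideanSpace ℝ (Fin m) → ℝ} (hf : ContDiffOn ℝ 1 f U) :
    D.InDomain (f ∘ D.coordMap φ) ∧
      D.seminormZ φ (dForm f) ^ 2 = D.energy (f ∘ D.coordMap φ) (f ∘ D.coordMap φ) := by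
  obtain ⟨u, hu, hu'⟩ := exists_core_chain_rule hU hKU hf
  rw [← hu]
  refine ⟨u.2.2.2, ?_⟩
  have h := norm_sum_tensor_sq φ fun i => pullback hKU (isContForm_dForm hU hf i)
  change D.seminormZ φ (dForm f) ^ 2 = _ at h
  rw [h, energy_core, ← gamma_one, hu']
  refine Finset.sum_congr rfl fun i _ => ?_
  rw [gamma_comm, hu']
  refine Finset.sum_congr rfl fun j _ => ?_
  rw [gamma_comm, one_mul]

lemma formMap_dForm_eq_zero (hU : IsOpen U) (hKU : Set.range (D.coordMap φ) ⊆ U)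
    {f : EuclideanSpace ℝ (Fin m) → ℝ} (hf : f ∈ vanishingIdeal U (Set.range (D.coordMap φ))) :
    D.formMap φ (dForm f) = 0 := by
  have h := (seminormZ_dForm_sq (φ := φ) hU hKU hf.1.1).2
  have h0 : f ∘ D.coordMap φ = (0 : D.core).1 := by
    ext x
    exact hf.2 _ ⟨x, rfl⟩
  rw [h0, energy_core, map_zero, seminormZ] at h
  simpa using h

/-- Here `f ∘ Φ` is the zero element, so Γ(f∘Φ, φʲ) = 0; the chain rule expresses this as a
vanishing density. -/
lemma sum_Z_mul_dForm_ae (hφ : D.IsCoordinateSequence φ) (hU : IsOpen U)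
    (hKU : Set.range (D.coordMap φ) ⊆ U) {f : EuclideanSpace ℝ (Fin m) → ℝ}
    (hf : f ∈ vanishingIdeal U (Set.range (D.coordMap φ))) (j : Fin m) :
    ∀ᵐ x ∂μ, ∑ i, D.Z φ x j i * dForm f i (D.coordMap φ x) = 0 := by
  obtain ⟨u, hu, hu'⟩ := exists_core_chain_rule (φ := φ) hU hKU hf.1.1
  have hu0 : u = 0 := by
    refine Subtype.ext (hu.trans ?_)
    ext x
    exact hf.2 _ ⟨x, rfl⟩
  set v := fun i => pullback hKU (isContForm_dForm hU hf.1.1 i) with hv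
  have hint : ∀ i, Integrable (fun x => v i x * D.Z φ x j i) μ := fun i =>
    integrable_continuous_mul (integrable_Z hφ j i) (v i)
  have h := ae_eq_zero_of_forall_integral_continuous_mul
    (integrable_finsetSum Finset.univ fun i _ => hint i) fun g => by
      simp only [Finset.mul_sum]
      rw [integral_finsetSum _ fun i _ => integrable_continuous_mul (hint i) g]
      have h1 := hu' (φ j) g
      rw [hu0, map_zero, LinearMap.zero_apply, zero_apply] at h1
      rw [h1]
      refine Finset.sum_congr rfl fun i _ => ?_
      rw [gamma_comm, gamma_eq_integral_Z hφ]
      simp only [ContinuousMap.mul_apply, mul_assoc, hv]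
  filter_upwards [h] with x hx
  rw [← show _ = (0 : ℝ) from hx]
  exact Finset.sum_congr rfl fun i _ => mul_comm _ _

/-- The exceptional null set of each `f` must not depend on `f`. The pulled-back gradients form a
subset of the separable space C(K)ᵐ, and at fixed `x` the condition is closed in the gradient, so a
countable dense subset decides it. -/
lemma forall_sum_Z_mul_dForm_ae (hφ : D.IsCoordinateSequence φ) (hU : IsOpen U)
    (hKU : Set.range (D.coordMap φ) ⊆ U) :
    ∀ᵐ x ∂μ, ∀ f ∈ vanishingIdeal U (Set.range (D.coordMap φ)), ∀ j,
      ∑ i, D.Z φ x j i * dForm f i (D.coordMap φ x) = 0 := by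
  let I := vanishingIdeal U (Set.range (D.coordMap φ))
  let G : Set (Fin m → C(K, ℝ)) :=
    Set.range fun f : I => fun i => pullback hKU (isContForm_dForm hU f.2.1.1 i)
  obtain ⟨s, hs, hsd⟩ := TopologicalSpace.exists_countable_dense G
  have hae : ∀ᵐ x ∂μ, ∀ v ∈ s, ∀ j, ∑ i, D.Z φ x j i * v.1 i x = 0 := by
    rw [ae_ball_iff hs]
    rintro ⟨v, ⟨f, rfl⟩⟩ _
    rw [ae_all_iff]
    exact fun j => sum_Z_mul_dForm_ae hφ hU hKU f.2 j
  filter_upwards [hae] with x hx f hf j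
  have hcl : IsClosed {v : G | ∑ i, D.Z φ x j i * v.1 i x = 0} := by
    refine isClosed_eq (continuous_finsetSum _ fun i _ => ?_) continuous_const
    exact continuous_const.mul ((continuous_eval_const (F := C(K, ℝ)) x).comp
      ((continuous_apply i).comp continuous_subtype_val))
  have hall := hcl.closure_subset_iff.2 (fun v hv => hx v hv j)
  exact hall (hsd ⟨_, ⟨f, hf⟩, rfl⟩)

lemma fderiv_apply_eq_sum (f : EuclideanSpace ℝ (Fin m) → ℝ) (p X : EuclideanSpace ℝ (Fin m)) :
    fderiv ℝ f p X = ∑ i, X i * dForm f i p := by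
  conv_lhs => rw [← (EuclideanSpace.basisFun (Fin m) ℝ).sum_repr X]
  simp [dForm]

/-- Self-adjointness of the projection in coordinates; it gives both the symmetry of P and the
reading of a row times P as the projected row. -/
lemma starProjection_apply_eq_sum (T : Submodule ℝ (EuclideanSpace ℝ (Fin m)))
    (z : EuclideanSpace ℝ (Fin m)) (k : Fin m) :
    T.starProjection z k = ∑ i, z i * T.starProjection (EuclideanSpace.single k 1) i := by
  have h := T.inner_starProjection_left_eq_right z (EuclideanSpace.single k 1)
  rw [EuclideanSpace.inner_single_right] at h
  simpa [PiLp.inner_apply, mul_comm] using h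

lemma tangentProj_mul_Z_mul_tangentProj_ae (hφ : D.IsCoordinateSequence φ) (hU : IsOpen U)
    (hKU : Set.range (D.coordMap φ) ⊆ U) :
    ∀ᵐ x ∂μ, tangentProj U (Set.range (D.coordMap φ)) (D.coordMap φ x) * D.Z φ x *
      tangentProj U (Set.range (D.coordMap φ)) (D.coordMap φ x) = D.Z φ x := by
  have hsymm : ∀ᵐ x ∂μ, ∀ i j, D.Z φ x i j = D.Z φ x j i := by
    rw [ae_all_iff]
    intro i
    rw [ae_all_iff]
    exact fun j => Z_symm_ae hφ i j
  filter_upwards [hsymm, forall_sum_Z_mul_dForm_ae hφ hU hKU] with x hx hz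
  set T := tangentSpaceOf U (Set.range (D.coordMap φ)) (D.coordMap φ x) with hT
  set P := tangentProj U (Set.range (D.coordMap φ)) (D.coordMap φ x) with hP
  have hPa : ∀ i j, P i j = T.starProjection (EuclideanSpace.single j 1) i := fun i j => rfl
  have hPsymm : P.transpose = P := by
    ext i j
    rw [Matrix.transpose_apply, hPa, hPa, starProjection_apply_eq_sum, Finset.sum_eq_single i]
    · simp
    · intro k _ hk
      simp [hk]
    · simp
  have hZP : D.Z φ x * P = D.Z φ x := by
    ext j k
    -- Each row of Z_x annihilates the differentials of the ideal, so it is a tangent vector and is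
    -- fixed by the projection.
    have hmem : (WithLp.toLp 2 fun i => D.Z φ x j i : EuclideanSpace ℝ (Fin m)) ∈ T := by
      intro f hf
      rw [fderiv_apply_eq_sum]
      exact hz f hf j
    have h1 := starProjection_apply_eq_sum T (WithLp.toLp 2 fun i => D.Z φ x j i) k
    rw [Submodule.starProjection_eq_self_iff.2 hmem] at h1
    rw [Matrix.mul_apply]
    exact h1.symm
  have hZ : (D.Z φ x).transpose = D.Z φ x := by
    ext i j
    exact hx j i
  have hPZ : P * D.Z φ x = D.Z φ x := by
    rw [← hPsymm, ← hZ, ← Matrix.transpose_mul, hZP]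
  rw [hPZ, hZP]

end Coordinates

/-! ### Compactness of K -/

section Compactness

variable {K : Type*} [TopologicalSpace K] [MeasurableSpace K] {μ : Measure K}
  {D : DirichletForm μ} {m : ℕ} {φ : Fin m → D.core}

lemma one_mem_core (hφ : D.IsCoordinateSequence φ) : (1 : K → ℝ) ∈ D.core := by
  have hb : ∀ i, ∃ C, ∀ x, |(φ i).1 x| ≤ C := fun i =>
    (φ i).2.2.1.exists_bound_of_continuous (φ i).2.1
  choose C hC using hb
  have hbound : ∀ x, ‖D.coordMap φ x‖ ≤ √(∑ i, C i ^ 2) := by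
    intro x
    rw [EuclideanSpace.norm_eq]
    refine Real.sqrt_le_sqrt (Finset.sum_le_sum fun i _ => ?_)
    exact pow_le_pow_left₀ (norm_nonneg _) (hC i x) 2
  -- The inner radius exceeds the bound on ‖Φ‖, so the bump is 1 on the whole image. The composition
  -- is therefore the constant 1, and its compact support is all of `K`.
  let χ : ContDiffBump (0 : EuclideanSpace ℝ (Fin m)) :=
    ⟨√(∑ i, C i ^ 2) + 1, √(∑ i, C i ^ 2) + 2, by positivity, by linarith⟩
  have hχ : (χ : EuclideanSpace ℝ (Fin m) → ℝ) ∈ C10 Set.univ := by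
    refine ⟨χ.contDiff.contDiffOn, χ.continuous.continuousOn, ?_⟩
    exact χ.hasCompactSupport.is_zero_at_infty.mono_left inf_le_left
  convert hφ.comp_mem χ hχ using 1
  ext x
  refine (χ.one_of_mem_closedBall ?_).symm
  rw [mem_closedBall_zero_iff]
  exact (hbound x).trans (by simp [χ])

lemma compactSpace_of_isCoordinateSequence (hφ : D.IsCoordinateSequence φ) : CompactSpace K := by
  have h := (one_mem_core hφ).2.1
  rw [HasCompactSupport, tsupport, Function.support_one, closure_univ] at h
  exact ⟨h⟩

end Compactness

end DirichletForm

end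

theorem mainTheorem8 {K : Type*} [MetricSpace K] [LocallyCompactSpace K] [MeasurableSpace K]
    [BorelSpace K] (μ : Measure K) [μ.Regular] [SigmaFinite μ] [μ.IsOpenPosMeasure]
    (D : DirichletForm μ) (hreg : D.IsRegular) (hloc : D.IsStronglyLocal)
    {m : ℕ} (φ : Fin m → D.core) (hφ : D.IsCoordinateSequence φ)
    (U : Set (EuclideanSpace ℝ (Fin m))) (hU : IsOpen U)
    (hKU : Set.range (D.coordMap φ) ⊆ U) :
    -- the objects in the statement are well defined
    (∀ f : D.core, D.IsEnergyMeasure f (D.energyMeasure f)) ∧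
    D.IsTensorForm D.tensorForm ∧
    (∀ ω : Fin m → EuclideanSpace ℝ (Fin m) → ℝ, IsContForm U ω → ∀ i,
      (D.uniformNhds (ω i ∘ D.coordMap φ)).NeBot ∧
      Tendsto (fun b : D.core => (D.simpleTensor (φ i) b : D.H))
        (D.uniformNhds (ω i ∘ D.coordMap φ))
        (𝓝 (D.tensor (φ i) (ω i ∘ D.coordMap φ)))) ∧
    -- the formula for the seminorm
    (∀ ω : Fin m → EuclideanSpace ℝ (Fin m) → ℝ, IsContForm U ω →
      (∀ i j, Integrable
        (fun x => ω i (D.coordMap φ x) * D.Z φ x i j * ω j (D.coordMap φ x)) μ) ∧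
      D.seminormZ φ ω ^ 2 =
        ∫ x, ∑ i, ∑ j, ω i (D.coordMap φ x) * D.Z φ x i j * ω j (D.coordMap φ x) ∂μ) ∧
    -- exact forms
    (∀ f ∈ C10 U, D.InDomain (f ∘ D.coordMap φ) ∧
      D.seminormZ φ (dForm f) ^ 2 = D.energy (f ∘ D.coordMap φ) (f ∘ D.coordMap φ)) ∧
    -- differentials of functions vanishing on the image of `Φ` are in the kernel of `π`
    (∀ f ∈ vanishingIdeal U (Set.range (D.coordMap φ)), D.formMap φ (dForm f) = 0) ∧
    -- invariance of `Z` under the projections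
    (∀ᵐ x ∂μ,
      tangentProj U (Set.range (D.coordMap φ)) (D.coordMap φ x) * D.Z φ x *
        tangentProj U (Set.range (D.coordMap φ)) (D.coordMap φ x) = D.Z φ x) := by
  have := DirichletForm.compactSpace_of_isCoordinateSequence hφ
  have : D.UnitalLocal := ⟨DirichletForm.one_mem_core hφ, hloc, hreg⟩
  exact ⟨fun f => DirichletForm.isEnergyMeasure_energyMeasure f, D.isTensorForm_tensorForm,
    fun ω hω i => ⟨DirichletForm.uniformNhds_neBot (DirichletForm.pullback hKU (hω i)),
      DirichletForm.tendsto_tensor (φ i) (DirichletForm.pullback hKU (hω i))⟩,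
    fun ω hω => DirichletForm.seminormZ_sq hφ hKU hω,
    fun f hf => DirichletForm.seminormZ_dForm_sq hU hKU hf.1,
    fun f hf => DirichletForm.formMap_dForm_eq_zero hU hKU hf,
    DirichletForm.tangentProj_mul_Z_mul_tangentProj_ae hφ hU hKU⟩
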